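/- Let $G=(V,E)$ be a connected simple graph with $d=\sup_{v\in V}\deg(v)<\infty$, let $S\subset V$ be a nonempty connected vertex set (that is, the subgraph $(S,\mathsf E_S)$ with $\mathsf E_S=\{e\in E: e\subset S\}$ is connected), and let $\Gamma\subset\mathrm{Aut}(G)$ be a subgroup such that $\Gamma|_S$ acts transitively by automorphisms on $(S,\mathsf E_S)$: $g(S)=S$ for every $g\in\Gamma$, and for all $u,v\in S$ there is $g\in\Gamma$ with $g(u)=v$. Suppose that $(S,\mathsf E_S)$ is amenable, i.e. for every $\varepsilon>0$ there is a finite nonempty $K\subset S$ such that at most $\varepsilon|K|$ vertices of $K$ have a neighbour in $S\setminus K$. For $p,q\in[0,1]$ let $P_{p,q}$ be the Bernoulli bond percolation measure on $\{0,1\}^E$ under which the edges are independent, each edge of $\mathsf E_S$ is open with probability $q$ and each edge of $E\setminus\mathsf E_S$ is open with probability $p$; let $E_{p,q}$ be its expectation. Write $u\leftrightarrow v$ if $u=v$ or $u$ and $v$ are joined by a path of open edges. The cluster of $u$ is $\{v\in V: u\leftrightarrow v\}$, and $N_\infty$ is the number of infinite clusters. For finite $R\subset V$ let $\Delta R=\{y\in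 V\setminus R:\exists x\in R,\ \{x,y\}\in E\}$, and for finite $S'\subset V$ let $\mathcal C(S';S)=\{u\in S':\exists v\in S,\ v\leftrightarrow u\}$. Then for every $q\in[0,1]$ and every $p\in[0,1]$ with $p<1/d^2$ (i.e. $pd^2<1$), there is a sequence $(R_n)_{n\in\mathbb N}$ of finite subsets of $V$ with $R_n\cap S\neq\emptyset$ such that $$\frac{E_{p,q}|\mathcal C(\Delta R_n;S)|}{|R_n\cap S|}\xrightarrow[n\to\infty]{}0,$$ and $N_\infty\in\{0,1\}$ holds $P_{p,q}$-almost surely. -/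

import Mathlib

open MeasureTheory ProbabilityTheory Filter Topology unitInterval
open scoped ENNReal

namespace InhomogeneousPercolation

/-- The interior vertex boundary of `K` in the graph `G`: the vertices of `K` that have a
neighbour outside `K`. -/
def interiorBoundary {V : Type*} (G : SimpleGraph V) (K : Set V) : Set V :=
  {y | y ∈ K ∧ ∃ x, x ∉ K ∧ G.Adj x y}

/-- The exterior vertex boundary of `K` in the graph `G`: the vertices outside `K` that have a
neighbour in `K`. -/
def exteriorBoundary {V : Type*} (G : SimpleGraph V) (K : Set V) : Set V :=
  {y | y ∉ K ∧ ∃ x, x ∈ K ∧ G.Adj x y}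

/-- Amenability of a graph: finite nonempty vertex sets can have an arbitrarily small proportion
of boundary vertices. -/
def IsAmenable {V : Type*} (G : SimpleGraph V) : Prop :=
  ∀ ε : ℝ, 0 < ε → ∃ K : Finset V, K.Nonempty ∧
    ((interiorBoundary G (K : Set V)).ncard : ℝ) ≤ ε * (K.card : ℝ)

/-- The restrictions to `S` of the elements of `Γ` are automorphisms of the subgraph induced by
`S` (that is, every element of `Γ` maps `S` onto `S`), and they act transitively on it. -/
def RestrictionActsTransitively {V : Type*} {G : SimpleGraph V} (Γ : Subgroup (G ≃g G))
    (S : Set V) : Prop :=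
  (∀ g ∈ Γ, g '' S = S) ∧ ∀ u ∈ S, ∀ v ∈ S, ∃ g ∈ Γ, g u = v

/-- Bond configurations: `true` is open, `false` is closed. -/
abbrev Config {V : Type*} (G : SimpleGraph V) : Type _ := G.edgeSet → Bool

/-- The graph of open edges of a configuration. -/
def openGraph {V : Type*} (G : SimpleGraph V) (ω : Config G) : SimpleGraph V :=
  SimpleGraph.fromEdgeSet {e | ∃ h : e ∈ G.edgeSet, ω ⟨e, h⟩ = true}

/-- The cluster of `u`: all vertices joined to `u` by an open path (`u` included). -/
def cluster {V : Type*} (G : SimpleGraph V) (ω : Config G) (u : V) : Set V :=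
  {v | (openGraph G ω).Reachable u v}

/-- The number of infinite clusters. -/
noncomputable def numInfiniteClusters {V : Type*} (G : SimpleGraph V) (ω : Config G) : ℕ∞ :=
  {C : Set V | C.Infinite ∧ ∃ u, C = cluster G ω u}.encard

/-- The set of the vertices of `A` that are connected to some vertex of `S` by an open path. -/
def connectedTo {V : Type*} (G : SimpleGraph V) (ω : Config G) (A S : Set V) : Set V :=
  {u | u ∈ A ∧ ∃ v ∈ S, (openGraph G ω).Reachable v u}

open Classical in
/-- Inhomogeneous Bernoulli bond percolation: the edges are independent, an edge with both
endpoints in `S` is open with probability `q`, any other edge with probability `p`. -/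
noncomputable def percMeasure {V : Type*} (G : SimpleGraph V) (S : Set V) (p q : I) :
    Measure (Config G) :=
  Measure.infinitePi fun e : G.edgeSet =>
    bernoulliMeasure true false (if ∀ v ∈ (e : Sym2 V), v ∈ S then q else p)

/-- The expected number of vertices of `A` that are connected to `S`. -/
noncomputable def expectedConnected {V : Type*} (G : SimpleGraph V) (S : Set V) (p q : I)
    (A : Set V) : ℝ≥0∞ :=
  ∫⁻ ω, ((connectedTo G ω A S).encard : ℝ≥0∞) ∂(percMeasure G S p q)

end InhomogeneousPercolation

namespace InhomogeneousPercolation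

/-! ### Counting walks, spheres and balls in a graph of bounded degree -/

section Counting

variable {V : Type*} (G : SimpleGraph V) [G.LocallyFinite] {d : ℕ}

/-! Small boundary: let `K` be a Følner set of `S` and `R` its `r`-neighbourhood in `G`. A vertex of
`ΔR` lies at distance exactly `r + 1` from `K`. If it is connected to `S`, follow an open path up to
its first vertex in `S`; this part uses only edges of parameter `p`. If it has length at least `r +
1`, a path count bounds the probability by `(pd)^(r+1)`, and there are at most `|K| d^(r+1)` such
vertices, hence the condition `pd² < 1`. Otherwise it ends in `S \ K` within distance `2r + 1` of
`K`, hence near the boundary of `K` in `S`, and amenability makes these vertices few. Fixing `r`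
before `K` gives `exists_expectedConnected_le`.

Uniqueness follows Burton and Keane, with the vertices of `ΔR` connected to `S` in the role of the
boundary. Disjoint trifurcation regions in `R ∩ S` are at most as many as these vertices
(`card_le_of_trifurcations`). A trifurcation of positive probability would, by transitivity on `S`,
produce a number of them proportional to `|K|`, a contradiction (`measure_trifEvent_eq_zero`). Since
`pd < 1`, clusters off the edges of `S` are finite, so every infinite cluster meets `S`. For `q >
0`, opening a finite connected piece of `S` would turn three infinite clusters into a trifurcation,
so there are at most two. Opening such a piece would also merge exactly two into one, which the
zero-one law for "at least two" excludes when `S` is infinite. If `S` is finite or `q = 0`, there is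
no infinite cluster at all. Edges are only ever opened inside `S`, so `p = 0` needs no separate
treatment. -/

theorem exists_finset_walks (hd : ∀ v, G.degree v ≤ d) (m : ℕ) (v : V) :
    ∃ F : Finset (Σ w, G.Walk v w), (∀ p : Σ w, G.Walk v w, p.2.length = m → p ∈ F) ∧
      F.card ≤ d ^ m := by
  classical
  induction m generalizing v with
  | zero =>
    refine ⟨{⟨v, .nil⟩}, ?_, by simp⟩
    rintro ⟨w, p⟩ hp
    cases p with
    | nil => simp
    | cons h p => simp at hp
  | succ m ih =>
    choose F hF hc using ih
    refine ⟨(Finset.univ : Finset (G.neighborSet v)).biUnion fun w =>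
      (F w).image fun p => (⟨p.1, .cons w.2 p.2⟩ : Σ x, G.Walk v x), ?_, ?_⟩
    · rintro ⟨w, p⟩ hp
      cases p with
      | nil => simp at hp
      | @cons _ x _ h p =>
        simp only [SimpleGraph.Walk.length_cons, Nat.add_right_cancel_iff] at hp
        simp only [Finset.mem_biUnion, Finset.mem_univ, true_and, Finset.mem_image]
        exact ⟨⟨x, h⟩, ⟨w, p⟩, hF x ⟨w, p⟩ hp, rfl⟩
    · refine (Finset.card_biUnion_le_card_mul _ _ (d ^ m) ?_).trans ?_
      · exact fun w _ => Finset.card_image_le.trans (hc w)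
      rw [Finset.card_univ, G.card_neighborSet_eq_degree, pow_succ']
      exact Nat.mul_le_mul_right _ (hd v)

theorem exists_finset_sphere (hG : G.Connected) (hd : ∀ v, G.degree v ≤ d) (m : ℕ)
    (K : Finset V) :
    ∃ F : Finset V, (∀ k ∈ K, ∀ v, G.dist k v = m → v ∈ F) ∧ F.card ≤ K.card * d ^ m := by
  classical
  choose W hW hc using exists_finset_walks G hd m
  refine ⟨K.biUnion fun k => (W k).image fun p => p.1, ?_, ?_⟩
  · intro k hk v hv
    obtain ⟨p, hp⟩ := hG.exists_walk_length_eq_dist k v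
    simp only [Finset.mem_biUnion, Finset.mem_image]
    exact ⟨k, hk, ⟨v, p⟩, hW k ⟨v, p⟩ (hp.trans hv), rfl⟩
  · exact Finset.card_biUnion_le_card_mul _ _ _ fun k _ => Finset.card_image_le.trans (hc k)

theorem exists_finset_ball (hG : G.Connected) (hd : ∀ v, G.degree v ≤ d) (m : ℕ)
    (K : Finset V) :
    ∃ F : Finset V, (∀ k ∈ K, ∀ v, G.dist k v ≤ m → v ∈ F) ∧
      F.card ≤ K.card * ∑ i ∈ Finset.range (m + 1), d ^ i := by
  classical
  choose W hW hc using fun i => exists_finset_sphere G hG hd i K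
  refine ⟨(Finset.range (m + 1)).biUnion W, fun k hk v hv => ?_, ?_⟩
  · simp only [Finset.mem_biUnion, Finset.mem_range]
    exact ⟨G.dist k v, by omega, hW _ k hk v rfl⟩
  · rw [Finset.mul_sum]
    exact Finset.card_biUnion_le.trans (Finset.sum_le_sum fun i _ => hc i)

theorem finite_ball (hG : G.Connected) (hd : ∀ v, G.degree v ≤ d) (m : ℕ) (o : V) :
    {v | G.dist o v ≤ m}.Finite := by
  obtain ⟨F, hF, -⟩ := exists_finset_ball G hG hd m {o}
  exact F.finite_toSet.subset fun v hv => hF o (by simp) v hv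

theorem countable_of_locallyFinite (hG : G.Connected) (hd : ∀ v, G.degree v ≤ d) :
    Countable V := by
  obtain ⟨o⟩ := hG.nonempty
  rw [← Set.countable_univ_iff]
  refine (Set.countable_iUnion fun m => (finite_ball G hG hd m o).countable).mono fun v _ => ?_
  exact Set.mem_iUnion.2 ⟨G.dist o v, le_refl (G.dist o v)⟩

end Counting

/-! ### Deterministic bound on the number of disjoint trifurcation regions -/

section Trifurcation

variable {V : Type*}

/-- The graph `H` with all edges that touch `B` deleted. -/
def avoid (H : SimpleGraph V) (B : Set V) : SimpleGraph V where
  Adj x y := H.Adj x y ∧ x ∉ B ∧ y ∉ B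
  symm := ⟨fun _ _ h => ⟨h.1.symm, h.2.2, h.2.1⟩⟩
  loopless := ⟨fun _ h => h.1.ne rfl⟩

/-- `y` lies outside `B`, in a component of `avoid H B` with an `H`-edge to `B`. -/
def Attached (H : SimpleGraph V) (B : Set V) (y : V) : Prop :=
  y ∉ B ∧ ∃ z b, b ∈ B ∧ z ∉ B ∧ H.Adj z b ∧ (avoid H B).Reachable y z

variable {H : SimpleGraph V} {B B' : Set V}

theorem avoid_le : avoid H B ≤ H := fun _ _ h => h.1

theorem notMem_of_avoid_reachable {x y : V} (h : (avoid H B).Reachable x y) (hx : x ∉ B) :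
    y ∉ B := by
  obtain ⟨p⟩ := h
  induction p with
  | nil => exact hx
  | cons h _ ih => exact ih h.2.2

/-- A component off `B` that never meets `B'` survives when `B'` is deleted in place of `B`:
restoring `B` only adds edges. -/
theorem avoid_reachable_of_free {x y : V}
    (hfree : ∀ w, (avoid H B).Reachable x w → w ∉ B')
    (h : (avoid H B).Reachable x y) : (avoid H B').Reachable x y := by
  obtain ⟨p⟩ := h
  induction p with
  | nil => exact .refl _
  | cons h _ ih =>
    have hx := hfree _ (.refl _)
    have hy := hfree _ (SimpleGraph.Adj.reachable h)
    refine (SimpleGraph.Adj.reachable (G := avoid H B') ⟨h.1, hx, hy⟩).trans (ih fun w hw => ?_)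
    exact hfree w ((SimpleGraph.Adj.reachable h).trans hw)

variable {ι : Type*} {B : ι → Set V} {J : Finset ι} {Y : Finset V}

/-- This finds a leaf of the tree-like arrangement of regions. If a branch at `B i` contains a
region `B l`, some branch at `B l` misses `B i`, since `B i` is connected off `B l` and so cannot
meet two of them. That branch sits inside the old one and no longer contains `B l`, so the number of
regions met drops strictly. -/
theorem exists_free_branch [DecidableEq ι]
    (hdisj : ∀ i ∈ J, ∀ j ∈ J, i ≠ j → Disjoint (B i) (B j))
    (hconn : ∀ i ∈ J, ∀ j ∈ J, i ≠ j → ∀ x ∈ B i, ∀ y ∈ B i, (avoid H (B j)).Reachable x y)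
    (hY : ∀ i ∈ J, ∃ y : Fin 3 → V, (∀ a, y a ∈ Y ∧ Attached H (B i) (y a)) ∧
      ∀ a b, a ≠ b → ¬ (avoid H (B i)).Reachable (y a) (y b))
    {i : ι} (hi : i ∈ J) {y : V} (hy : y ∈ Y) (hyi : Attached H (B i) y) :
    ∃ i ∈ J, ∃ y ∈ Y, Attached H (B i) y ∧
      ∀ l ∈ J, ∀ x ∈ B l, ¬ (avoid H (B i)).Reachable y x := by
  classical
  obtain ⟨n, hn⟩ : ∃ n, (J.filter fun l =>
    ∃ x ∈ B l, (avoid H (B i)).Reachable y x).card = n := ⟨_, rfl⟩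
  induction n using Nat.strong_induction_on generalizing i y with
  | _ n ih =>
  by_cases hfree : ∀ l ∈ J, ∀ x ∈ B l, ¬ (avoid H (B i)).Reachable y x
  · exact ⟨i, hi, y, hy, hyi, hfree⟩
  push Not at hfree
  obtain ⟨l, hl, x, hx, hyx⟩ := hfree
  have hli : l ≠ i := by
    rintro rfl
    exact notMem_of_avoid_reachable hyx hyi.1 hx
  obtain ⟨t, ht, htt⟩ := hY l hl
  obtain ⟨a, ha⟩ : ∃ a, ∀ w ∈ B i, ¬ (avoid H (B l)).Reachable (t a) w := by
    by_contra! hcon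
    obtain ⟨w0, hw0, h0⟩ := hcon 0
    obtain ⟨w1, hw1, h1⟩ := hcon 1
    exact htt 0 1 (by decide)
      (h0.trans ((hconn i hi l hl hli.symm w0 hw0 w1 hw1).trans h1.symm))
  obtain ⟨hta, htl, z, b, hb, hz, hzb, htz⟩ := ht a
  have hfr : ∀ w, (avoid H (B l)).Reachable (t a) w → w ∉ B i := fun w hw hwi => ha w hwi hw
  have hbi : b ∉ B i := Set.disjoint_left.1 (hdisj l hl i hi hli) hb
  have hyt : (avoid H (B i)).Reachable y (t a) := by
    refine hyx.trans ((hconn l hl i hi hli x hx b hb).trans ?_)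
    refine (SimpleGraph.Adj.reachable (G := avoid H (B i)) ⟨hzb.symm, hbi, hfr z htz⟩).trans ?_
    exact (avoid_reachable_of_free hfr htz).symm
  refine ih _ ?_ hl hta ⟨htl, z, b, hb, hz, hzb, htz⟩ rfl
  rw [← hn]
  apply Finset.card_lt_card
  rw [Finset.ssubset_iff_of_subset]
  · refine ⟨l, by simpa using ⟨hl, x, hx, hyx⟩, ?_⟩
    simp only [Finset.mem_filter, not_and, not_exists]
    exact fun _ w hw hr => notMem_of_avoid_reachable hr htl hw
  · intro k
    simp only [Finset.mem_filter]
    rintro ⟨hk, w, hw, hr⟩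
    exact ⟨hk, w, hw, hyt.trans (avoid_reachable_of_free hfr hr)⟩

/-- Induction on the number of regions: remove a region `B i` having a free branch, together with
the endpoint `y` of that branch. Any other region that used `y` can use another endpoint of `B i`
instead, reached through `B i`. -/
theorem card_le_of_trifurcations [DecidableEq ι]
    (hdisj : ∀ i ∈ J, ∀ j ∈ J, i ≠ j → Disjoint (B i) (B j))
    (hconn : ∀ i ∈ J, ∀ j ∈ J, i ≠ j → ∀ x ∈ B i, ∀ y ∈ B i, (avoid H (B j)).Reachable x y)
    (hY : ∀ i ∈ J, ∃ y : Fin 3 → V, (∀ a, y a ∈ Y ∧ Attached H (B i) (y a)) ∧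
      ∀ a b, a ≠ b → ¬ (avoid H (B i)).Reachable (y a) (y b)) :
    J.card ≤ Y.card := by
  classical
  obtain ⟨n, hn⟩ : ∃ n, J.card = n := ⟨_, rfl⟩
  induction n generalizing J Y with
  | zero => omega
  | succ n ih =>
  obtain ⟨i₀, hi₀⟩ : J.Nonempty := Finset.card_pos.1 (by omega)
  obtain ⟨t₀, ht₀, -⟩ := hY i₀ hi₀
  obtain ⟨i, hi, y, hy, ⟨hyi, z, b, hb, hz, hzb, hyz⟩, hfree⟩ :=
    exists_free_branch hdisj hconn hY hi₀ (ht₀ 0).1 (ht₀ 0).2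
  obtain ⟨t, ht, htt⟩ := hY i hi
  have key : (J.erase i).card ≤ (Y.erase y).card := by
    refine ih (fun i hi j hj => hdisj i (Finset.mem_of_mem_erase hi) j (Finset.mem_of_mem_erase hj))
      (fun i hi j hj => hconn i (Finset.mem_of_mem_erase hi) j (Finset.mem_of_mem_erase hj)) ?_
      (by rw [Finset.card_erase_of_mem hi]; omega)
    intro l hl
    obtain ⟨hli, hl⟩ := Finset.mem_erase.1 hl
    obtain ⟨w, hw, hww⟩ := hY l hl
    have hyfree : ∀ v, (avoid H (B i)).Reachable y v → v ∉ B l :=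
      fun v hv hvl => hfree l hl v hvl hv
    have hbl : b ∉ B l := Set.disjoint_left.1 (hdisj i hi l hl hli.symm) hb
    have hyb : (avoid H (B l)).Reachable y b :=
      (avoid_reachable_of_free hyfree hyz).trans
        (SimpleGraph.Adj.reachable (G := avoid H (B l)) ⟨hzb, hyfree z hyz, hbl⟩)
    -- Pigeonhole on three branches: at most one endpoint equals `y`, and at most one branch meets
    -- `B l`.
    obtain ⟨a, hay, ha⟩ : ∃ a, t a ≠ y ∧ ∀ x ∈ B l, ¬ (avoid H (B i)).Reachable (t a) x := by
      by_contra! hcon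
      have h1 : ∀ a c, a ≠ c → ¬ (t a = y ∧ t c = y) := fun a c hac ⟨h1, h2⟩ =>
        htt a c hac (by rw [h1, h2])
      have h2 : ∀ a c, a ≠ c → ¬ (t a ≠ y ∧ t c ≠ y) := by
        rintro a c hac ⟨h1, h2⟩
        obtain ⟨x, hx, hax⟩ := hcon a h1
        obtain ⟨x', hx', hcx⟩ := hcon c h2
        exact htt a c hac (hax.trans ((hconn l hl i hi hli x hx x' hx').trans hcx.symm))
      have := h1 0 1 (by decide)
      have := h1 0 2 (by decide)
      have := h1 1 2 (by decide)
      have := h2 0 1 (by decide)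
      have := h2 0 2 (by decide)
      have := h2 1 2 (by decide)
      tauto
    obtain ⟨hta, hti, z', b', hb', hz', hzb', htz'⟩ := ht a
    have htfree : ∀ v, (avoid H (B i)).Reachable (t a) v → v ∉ B l :=
      fun v hv hvl => ha v hvl hv
    have hbl' : b' ∉ B l := Set.disjoint_left.1 (hdisj i hi l hl hli.symm) hb'
    have hty : (avoid H (B l)).Reachable (t a) y :=
      (avoid_reachable_of_free htfree htz').trans
        ((SimpleGraph.Adj.reachable (G := avoid H (B l)) ⟨hzb', htfree z' htz', hbl'⟩).trans
          ((hconn i hi l hl hli.symm b' hb' b hb).trans hyb.symm))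
    have hr : ∀ c, (avoid H (B l)).Reachable (if w c = y then t a else w c) (w c) := by
      intro c
      split_ifs with h
      · rwa [h]
      · exact .refl _
    refine ⟨fun c => if w c = y then t a else w c, fun c => ⟨?_, ?_⟩, fun a c hac h => ?_⟩
    · rw [Finset.mem_erase]
      beta_reduce
      split_ifs with h
      · exact ⟨hay, hta⟩
      · exact ⟨h, (hw c).1⟩
    · obtain ⟨-, hc, z, b, hb, hz, hzb, hcz⟩ := hw c
      exact ⟨notMem_of_avoid_reachable (hr c).symm hc, z, b, hb, hz, hzb, (hr c).trans hcz⟩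
    · exact hww a c hac ((hr a).symm.trans (h.trans (hr c)))
  rw [Finset.card_erase_of_mem hi, Finset.card_erase_of_mem hy] at key
  have := Finset.card_pos.2 ⟨y, hy⟩
  omega

end Trifurcation

/-! ### Independent bits: insertion tolerance and a zero-one law -/

section BernoulliProduct

variable {ι : Type*} (a : ι → I)

/-- The law of independent bits, the `i`-th one being `true` with probability `a i`. -/
noncomputable def bitMeasure : Measure (ι → Bool) :=
  Measure.infinitePi fun i => bernoulliMeasure true false (a i)

instance : IsProbabilityMeasure (bitMeasure a) := by
  unfold bitMeasure; infer_instance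

theorem bernoulliMeasure_eq_add (b : I) (t : Set Bool) :
    bernoulliMeasure true false b t = (toNNReal b : ℝ≥0∞) * t.indicator 1 true +
      (toNNReal (σ b) : ℝ≥0∞) * t.indicator 1 false := by
  simp [bernoulliMeasure_def]
  rfl

theorem bitMeasure_forall_true (F : Finset ι) :
    bitMeasure a {ω | ∀ i ∈ F, ω i = true} = ∏ i ∈ F, (toNNReal (a i) : ℝ≥0∞) := by
  have : {ω : ι → Bool | ∀ i ∈ F, ω i = true} = Set.pi (F : Set ι) fun _ => {true} := by
    ext ω; simp [Set.mem_pi]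
  rw [this, bitMeasure, Measure.infinitePi_pi _ fun _ _ => MeasurableSet.of_discrete]
  exact Finset.prod_congr rfl fun i _ => by simp

theorem ae_eq_false_of_eq_zero [Countable ι] :
    ∀ᵐ ω ∂bitMeasure a, ∀ i, a i = 0 → ω i = false := by
  rw [ae_all_iff]
  intro i
  by_cases hi : a i = 0
  · rw [ae_iff]
    have := bitMeasure_forall_true a {i}
    simpa [hi] using this
  · simp [hi]

theorem measurable_update_const [DecidableEq ι] (e : ι) (b : Bool) :
    Measurable fun ω : ι → Bool => Function.update ω e b := by
  refine measurable_pi_lambda _ fun i => ?_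
  by_cases h : i = e
  · subst h; simp
  · simpa [Function.update_of_ne h] using measurable_pi_apply i

/-- Conditioning on a single bit. On finite-dimensional boxes, forcing the bit `e` affects only the
factor at `e`. -/
theorem bitMeasure_eq_add_map_update [DecidableEq ι] (e : ι) :
    bitMeasure a =
      (toNNReal (a e) : ℝ≥0∞) • (bitMeasure a).map (fun ω => Function.update ω e true) +
      (toNNReal (σ (a e)) : ℝ≥0∞) • (bitMeasure a).map (fun ω => Function.update ω e false) := by
  symm
  refine Measure.eq_infinitePi _ fun s t ht => ?_
  have hm : MeasurableSet (Set.pi (s : Set ι) t) :=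
    MeasurableSet.pi s.countable_toSet fun i _ => ht i
  have hadd : (toNNReal (a e) : ℝ≥0∞) + (toNNReal (σ (a e)) : ℝ≥0∞) = 1 := by
    have := bernoulliMeasure_eq_add (a e) Set.univ
    simpa using this.symm
  have key : ∀ b : Bool, bitMeasure a ((fun ω => Function.update ω e b) ⁻¹' Set.pi (s : Set ι) t) =
      (if e ∈ s then (t e).indicator 1 b else 1) *
        ∏ i ∈ s.erase e, bernoulliMeasure true false (a i) (t i) := by
    intro b
    by_cases he : e ∈ s
    · by_cases hb : b ∈ t e
      · have : (fun ω => Function.update ω e b) ⁻¹' Set.pi (s : Set ι) t =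
            Set.pi (s.erase e : Finset ι) t := by
          ext ω
          simp only [Set.mem_preimage, Set.mem_pi, Finset.mem_coe, Finset.mem_erase]
          constructor
          · intro h i hi
            simpa [Function.update_of_ne hi.1] using h i hi.2
          · intro h i hi
            by_cases hie : i = e
            · subst hie; simpa using hb
            · simpa [Function.update_of_ne hie] using h i ⟨hie, hi⟩
        rw [this, bitMeasure, Measure.infinitePi_pi _ fun i _ => ht i]
        simp [he, hb]
      · have : (fun ω => Function.update ω e b) ⁻¹' Set.pi (s : Set ι) t = ∅ := by
          ext ω
          simp only [Set.mem_preimage, Set.mem_pi, Finset.mem_coe, Set.mem_empty_iff_false,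
            iff_false]
          intro h
          exact hb (by simpa using h e he)
        rw [this]
        simp [he, hb]
    · have : (fun ω => Function.update ω e b) ⁻¹' Set.pi (s : Set ι) t = Set.pi (s : Set ι) t := by
        ext ω
        simp only [Set.mem_preimage, Set.mem_pi, Finset.mem_coe]
        refine forall₂_congr fun i hi => ?_
        rw [Function.update_of_ne (by rintro rfl; exact he hi)]
      rw [this, bitMeasure, Measure.infinitePi_pi _ fun i _ => ht i, Finset.erase_eq_of_notMem he]
      simp [he]
  rw [Measure.add_apply, Measure.smul_apply, Measure.smul_apply,
    Measure.map_apply (measurable_update_const e _) hm,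
    Measure.map_apply (measurable_update_const e _) hm, key, key, smul_eq_mul, smul_eq_mul,
    ← mul_assoc, ← mul_assoc, ← add_mul]
  by_cases he : e ∈ s
  · simp only [he, if_true]
    rw [← bernoulliMeasure_eq_add, Finset.mul_prod_erase s
      (fun i => bernoulliMeasure true false (a i) (t i)) he]
  · simp only [he, if_false, mul_one]
    rw [hadd, one_mul, Finset.erase_eq_of_notMem he]

/-- Set all bits in `F` to `true`. -/
def openOn [DecidableEq ι] (F : Finset ι) (ω : ι → Bool) : ι → Bool := fun i => if i ∈ F then true else ω i

theorem measurable_openOn [DecidableEq ι] (F : Finset ι) : Measurable (openOn F) := by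
  refine measurable_pi_lambda _ fun i => ?_
  by_cases h : i ∈ F
  · simp [openOn, h]
  · simpa [openOn, h] using measurable_pi_apply i

/-- Insertion tolerance: by the one-bit decomposition, the law dominates `a e` times its image under
opening `e`. Iterate over `F`. -/
theorem map_openOn_absolutelyContinuous [DecidableEq ι] (F : Finset ι) (hF : ∀ i ∈ F, a i ≠ 0) :
    (bitMeasure a).map (openOn F) ≪ bitMeasure a := by
  induction F using Finset.induction_on with
  | empty =>
    have : (openOn (∅ : Finset ι)) = id := by ext; simp [openOn]
    rw [this, Measure.map_id]
  | insert e F he ih =>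
    have hcomp : openOn (insert e F) = (fun ω => Function.update ω e true) ∘ openOn F := by
      ext ω i
      by_cases h : i = e
      · subst h; simp [openOn]
      · simp [openOn, h]
    rw [hcomp, ← Measure.map_map (measurable_update_const e true) (measurable_openOn F)]
    refine (Measure.AbsolutelyContinuous.map (ih fun i hi => hF i (Finset.mem_insert_of_mem hi))
      (measurable_update_const e true)).trans ?_
    refine Measure.AbsolutelyContinuous.mk fun s hs h0 => ?_
    rw [bitMeasure_eq_add_map_update a e] at h0
    simp only [Measure.add_apply, Measure.smul_apply, smul_eq_mul, add_eq_zero, mul_eq_zero] at h0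
    refine h0.1.resolve_left fun h => hF e (Finset.mem_insert_self e F) ?_
    rw [ENNReal.coe_eq_zero] at h
    exact Subtype.ext (congrArg NNReal.toReal h)

theorem map_precomp_bitMeasure (e : ι ≃ ι) (he : ∀ i, a (e i) = a i) :
    (bitMeasure a).map (fun ω i => ω (e i)) = bitMeasure a := by
  classical
  refine Measure.eq_infinitePi _ fun s t ht => ?_
  rw [Measure.map_apply (by fun_prop) (MeasurableSet.pi s.countable_toSet fun i _ => ht i)]
  have : (fun (ω : ι → Bool) i => ω (e i)) ⁻¹' Set.pi (s : Set ι) t =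
      Set.pi (s.map e.toEmbedding : Finset ι) fun i => t (e.symm i) := by
    ext ω
    simp only [Set.mem_preimage, Set.mem_pi, Finset.mem_coe, Finset.mem_map_equiv]
    exact ⟨fun h i hi => by simpa using h _ hi, fun h i hi => by simpa using h (e i) (by simpa)⟩
  rw [this, bitMeasure, Measure.infinitePi_pi _ fun i _ => ht _, Finset.prod_map]
  exact Finset.prod_congr rfl fun i _ => by simp [he]

theorem measure_inter_shift (s : Finset ι) (T : Set (s → Bool)) (hT : MeasurableSet T)
    (e : ι ≃ ι) (he : ∀ i, a (e i) = a i) (hd : ∀ i ∈ s, e i ∉ s) :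
    bitMeasure a (cylinder s T ∩ (fun ω i => ω (e i)) ⁻¹' cylinder s T) =
      bitMeasure a (cylinder s T) * bitMeasure a (cylinder s T) := by
  classical
  have hdis : Disjoint s (s.map e.toEmbedding) := by
    rw [Finset.disjoint_left]
    intro i hi hi'
    obtain ⟨j, hj, rfl⟩ := Finset.mem_map.1 hi'
    exact hd j hj hi
  have hind := (iIndepFun_infinitePi (P := fun i => bernoulliMeasure true false (a i))
    (X := fun _ ω => ω) (fun _ => measurable_id)).indepFun_finset s (s.map e.toEmbedding) hdis
    (fun i => measurable_pi_apply i)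
  let g : ({i // i ∈ s.map e.toEmbedding} → Bool) → (s → Bool) :=
    fun x i => x ⟨e i, Finset.mem_map_of_mem _ i.2⟩
  have hg : Measurable g := by fun_prop
  have h := (hind.comp measurable_id hg).measure_inter_preimage_eq_mul T T hT hT
  have hmap : bitMeasure a ((fun ω i => ω (e i)) ⁻¹' cylinder s T) =
      bitMeasure a (cylinder s T) := by
    conv_rhs => rw [← map_precomp_bitMeasure a e he]
    rw [Measure.map_apply (by fun_prop) (MeasurableSet.cylinder s hT)]
  conv_rhs => enter [2]; rw [← hmap]
  exact h

/-- Mixing argument: a cylinder approximating `A` and its shift off its own support are independent,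
and by invariance both approximate `A`, so `μ(A) = μ(A)²`. -/
theorem measure_eq_zero_or_one_of_invariant {A : Set (ι → Bool)} (hA : MeasurableSet A)
    (hinv : ∀ s : Finset ι, ∃ e : ι ≃ ι, (∀ i, a (e i) = a i) ∧ (∀ i ∈ s, e i ∉ s) ∧
      (fun ω i => ω (e i)) ⁻¹' A = A) :
    bitMeasure a A = 0 ∨ bitMeasure a A = 1 := by
  have hdense : (bitMeasure a).MeasureDense (measurableCylinders fun _ : ι => Bool) :=
    Measure.MeasureDense.of_generateFrom_isSetAlgebra_finite _ isSetAlgebra_measurableCylinders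
      generateFrom_measurableCylinders.symm
  set μ := bitMeasure a with hμ
  have key : ∀ ε : ℝ, 0 < ε → |μ.real A - μ.real A * μ.real A| ≤ 0 + ε := by
    intro ε hε
    -- Four errors of size `ε / 5` occur: two from the intersection with the shift, two from
    -- squaring the cylinder's measure.
    obtain ⟨t, ht, htA⟩ := hdense.approx A hA (measure_ne_top _ _) (ε / 5) (by positivity)
    obtain ⟨s, T, hT, rfl⟩ := (mem_measurableCylinders _).1 ht
    obtain ⟨e, he, hd, heA⟩ := hinv s
    have hmeas := MeasurableSet.cylinder (α := fun _ : ι => Bool) s hT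
    set θ : (ι → Bool) → (ι → Bool) := fun ω i => ω (e i) with hθ
    have hθm : Measurable θ := by fun_prop
    have h1 : μ.real (symmDiff A (cylinder s T)) ≤ ε / 5 := by
      rw [measureReal_def]
      exact ENNReal.toReal_le_of_le_ofReal (by positivity) htA.le
    have h2 : μ.real (symmDiff A (θ ⁻¹' cylinder s T)) ≤ ε / 5 := by
      have : symmDiff A (θ ⁻¹' cylinder s T) = θ ⁻¹' symmDiff A (cylinder s T) := by
        conv_lhs => rw [← heA]
        rfl
      rw [this, measureReal_def, ← Measure.map_apply hθm (hA.symmDiff hmeas), hθ,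
        map_precomp_bitMeasure a e he]
      exact h1
    have h3 : μ.real (cylinder s T ∩ θ ⁻¹' cylinder s T) =
        μ.real (cylinder s T) * μ.real (cylinder s T) := by
      simp only [measureReal_def, ← ENNReal.toReal_mul]
      rw [hμ, measure_inter_shift a s T hT e he hd]
    have h4 := abs_le.1 (abs_measureReal_sub_le_measureReal_symmDiff (μ := μ) hA.nullMeasurableSet
      hmeas.nullMeasurableSet)
    have h5 := abs_le.1 (abs_measureReal_sub_le_measureReal_symmDiff (μ := μ) hA.nullMeasurableSet
      (hmeas.inter (hθm hmeas)).nullMeasurableSet)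
    have h6 : μ.real (symmDiff A (cylinder s T ∩ θ ⁻¹' cylinder s T)) ≤
        μ.real (symmDiff A (cylinder s T)) + μ.real (symmDiff A (θ ⁻¹' cylinder s T)) := by
      refine (measureReal_mono ?_).trans (measureReal_union_le _ _)
      intro ω
      simp only [Set.mem_symmDiff, Set.mem_inter_iff, Set.mem_union]
      tauto
    have h7 : μ.real A ≤ 1 := measureReal_le_one
    have h8 : μ.real (cylinder s T) ≤ 1 := measureReal_le_one
    have h9 : 0 ≤ μ.real A := measureReal_nonneg
    have h10 : 0 ≤ μ.real (cylinder s T) := measureReal_nonneg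
    rw [h3] at h5
    rw [abs_le]
    constructor <;> nlinarith
  have h0 : |μ.real A - μ.real A * μ.real A| ≤ 0 := le_of_forall_pos_le_add key
  have h1 : μ.real A * (1 - μ.real A) = 0 := by
    have := abs_nonpos_iff.1 h0
    linarith
  rcases mul_eq_zero.1 h1 with h | h
  · left
    rwa [measureReal_eq_zero_iff] at h
  · right
    have h : μ.real A = 1 := by linarith
    rw [measureReal_def] at h
    exact (ENNReal.toReal_eq_one_iff _).1 h

end BernoulliProduct

/-! ### Measurability, and open paths off the edges of `S` -/

section RandomGraph

variable {V : Type*}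

theorem measurableSet_reachable {Ω : Type*} [MeasurableSpace Ω] [Countable V]
    (H : Ω → SimpleGraph V) (hH : ∀ x y, MeasurableSet {ω | (H ω).Adj x y}) (u v : V) :
    MeasurableSet {ω | (H ω).Reachable u v} := by
  have hW : ∀ n u, MeasurableSet {ω | ∃ p : (H ω).Walk u v, p.length = n} := by
    intro n
    induction n with
    | zero =>
      intro u
      simp only [SimpleGraph.Walk.exists_length_eq_zero_iff]
      exact MeasurableSet.const _
    | succ n ih =>
      intro u
      have : {ω | ∃ p : (H ω).Walk u v, p.length = n + 1} =
          ⋃ w, {ω | (H ω).Adj u w} ∩ {ω | ∃ p : (H ω).Walk w v, p.length = n} := by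
        ext ω
        simp only [Set.mem_ofPred_eq, Set.mem_iUnion, Set.mem_inter_iff]
        constructor
        · rintro ⟨p, hp⟩
          cases p with
          | nil => simp at hp
          | @cons _ w _ h p => exact ⟨w, h, p, by simpa using hp⟩
        · rintro ⟨w, h, p, hp⟩
          exact ⟨.cons h p, by simpa using hp⟩
      rw [this]
      exact MeasurableSet.iUnion fun w => (hH u w).inter (ih w)
  have : {ω | (H ω).Reachable u v} = ⋃ n, {ω | ∃ p : (H ω).Walk u v, p.length = n} := by
    ext ω
    simp only [Set.mem_ofPred_eq, Set.mem_iUnion]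
    exact ⟨fun ⟨p⟩ => ⟨_, p, rfl⟩, fun ⟨_, p, _⟩ => ⟨p⟩⟩
  rw [this]
  exact MeasurableSet.iUnion fun n => hW n u

theorem measurableSet_infinite {Ω : Type*} [MeasurableSpace Ω] [Countable V]
    (H : Ω → SimpleGraph V) (hH : ∀ x y, MeasurableSet {ω | (H ω).Adj x y}) (u : V) :
    MeasurableSet {ω | {v | (H ω).Reachable u v}.Infinite} := by
  have : {ω | {v | (H ω).Reachable u v}.Infinite} =
      ⋂ F : Finset V, ⋃ v : V, ⋃ _ : v ∉ F, {ω | (H ω).Reachable u v} := by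
    ext ω
    simp only [Set.mem_ofPred_eq, Set.mem_iInter, Set.mem_iUnion, exists_prop]
    constructor
    · intro h F
      obtain ⟨v, hv, hvF⟩ := h.exists_notMem_finset F
      exact ⟨v, hvF, hv⟩
    · intro h hfin
      obtain ⟨v, hv, hr⟩ := h hfin.toFinset
      exact hv (by simpa using hr)
  rw [this]
  exact MeasurableSet.iInter fun F => MeasurableSet.iUnion fun v => MeasurableSet.iUnion fun _ =>
    measurableSet_reachable H hH u v

variable {G : SimpleGraph V} {S : Set V} {ω : Config G}

theorem openGraph_adj {x y : V} :
    (openGraph G ω).Adj x y ↔ ∃ h : G.Adj x y, ω ⟨s(x, y), h⟩ = true := by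
  simp only [openGraph, SimpleGraph.fromEdgeSet_adj]
  exact ⟨fun h => h.1, fun h => ⟨h, h.1.ne⟩⟩

theorem openGraph_le : openGraph G ω ≤ G := fun _ _ h => (openGraph_adj.1 h).1

theorem measurableSet_openGraph_adj (x y : V) :
    MeasurableSet {ω : Config G | (openGraph G ω).Adj x y} := by
  by_cases h : G.Adj x y
  · have : {ω : Config G | (openGraph G ω).Adj x y} = (fun ω => ω ⟨s(x, y), h⟩) ⁻¹' {true} := by
      ext ω
      simp [openGraph_adj, h]
    rw [this]
    exact measurable_pi_apply _ (MeasurableSet.of_discrete)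
  · simp [openGraph_adj, h]

/-- The open edges that do not lie inside `S`. -/
def offGraph (G : SimpleGraph V) (S : Set V) (ω : Config G) : SimpleGraph V where
  Adj x y := (openGraph G ω).Adj x y ∧ ¬ (x ∈ S ∧ y ∈ S)
  symm := ⟨fun _ _ h => ⟨h.1.symm, fun h' => h.2 h'.symm⟩⟩
  loopless := ⟨fun _ h => h.1.ne rfl⟩

theorem offGraph_le_openGraph : offGraph G S ω ≤ openGraph G ω := fun _ _ h => h.1

theorem offGraph_le : offGraph G S ω ≤ G := offGraph_le_openGraph.trans openGraph_le

theorem of_mem_edgeSet_offGraph {e : Sym2 V} (he : e ∈ (offGraph G S ω).edgeSet) :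
    ∃ h : e ∈ G.edgeSet, ω ⟨e, h⟩ = true ∧ ¬ ∀ v ∈ e, v ∈ S := by
  induction e using Sym2.ind with
  | _ x y =>
    obtain ⟨h1, h2⟩ := he
    obtain ⟨h, h3⟩ := openGraph_adj.1 h1
    exact ⟨h, h3, by simpa using h2⟩

open Classical in
/-- The probability that an edge is open. -/
noncomputable def edgeProb (G : SimpleGraph V) (S : Set V) (p q : I) (e : G.edgeSet) : I :=
  if ∀ v ∈ (e : Sym2 V), v ∈ S then q else p

theorem percMeasure_eq (p q : I) : percMeasure G S p q = bitMeasure (edgeProb G S p q) := rfl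

instance (p q : I) : IsProbabilityMeasure (percMeasure G S p q) := by
  rw [percMeasure_eq]; infer_instance

/-- There is a path of length `m` from `y` that is open and uses no edge inside `S`. -/
def farEvent (G : SimpleGraph V) (S : Set V) (m : ℕ) (y : V) : Set (Config G) :=
  {ω | ∃ v, ∃ p : (offGraph G S ω).Walk y v, p.IsPath ∧ p.length = m}

/-- The edges of a path are distinct, hence independent, each open with probability `p`. For other
walks the event is empty. -/
theorem measure_openPath_le (p q : I) {u v : V} (w : G.Walk u v) :
    percMeasure G S p q {ω | w.IsPath ∧ ∀ e ∈ w.edges,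
      ∃ h : e ∈ G.edgeSet, ω ⟨e, h⟩ = true ∧ ¬ ∀ v ∈ e, v ∈ S} ≤
      (toNNReal p : ℝ≥0∞) ^ w.length := by
  classical
  by_cases hw : w.IsPath ∧ ∀ e ∈ w.edges, ¬ ∀ v ∈ e, v ∈ S
  · set F : Finset G.edgeSet := w.edges.toFinset.subtype (· ∈ G.edgeSet) with hF
    have hcard : F.card = w.length := by
      rw [hF, Finset.card_subtype, Finset.filter_true_of_mem,
        List.toFinset_card_of_nodup hw.1.isTrail.edges_nodup, w.length_edges]
      exact fun e he => w.edges_subset_edgeSet (List.mem_toFinset.1 he)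
    have hmem : ∀ i ∈ F, (i : Sym2 V) ∈ w.edges := fun i hi => by simpa [hF] using hi
    refine (measure_mono (t := {ω | ∀ i ∈ F, ω i = true}) ?_).trans ?_
    · rintro ω ⟨-, h⟩ i hi
      exact (h i (hmem i hi)).2.1
    · rw [percMeasure_eq, bitMeasure_forall_true, ← hcard, ← Finset.prod_const]
      refine le_of_eq (Finset.prod_congr rfl fun i hi => ?_)
      rw [edgeProb, if_neg (hw.2 i (hmem i hi))]
  · rw [not_and] at hw
    have : {ω : Config G | w.IsPath ∧ ∀ e ∈ w.edges,
        ∃ h : e ∈ G.edgeSet, ω ⟨e, h⟩ = true ∧ ¬ ∀ v ∈ e, v ∈ S} = ∅ := by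
      ext ω
      simp only [Set.mem_ofPred_eq, Set.mem_empty_iff_false, iff_false]
      rintro ⟨h1, h2⟩
      exact hw h1 fun e he => (h2 e he).2.2
    rw [this]
    simp

theorem measure_farEvent_le [G.LocallyFinite] {d : ℕ} (hd : ∀ v, G.degree v ≤ d) (p q : I)
    (m : ℕ) (y : V) :
    percMeasure G S p q (farEvent G S m y) ≤ ((toNNReal p : ℝ≥0∞) * d) ^ m := by
  obtain ⟨F, hF, hc⟩ := exists_finset_walks G hd m y
  set F' := F.filter fun w => w.2.length = m
  have hsub : farEvent G S m y ⊆ ⋃ w ∈ F', {ω | w.2.IsPath ∧ ∀ e ∈ w.2.edges,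
      ∃ h : e ∈ G.edgeSet, ω ⟨e, h⟩ = true ∧ ¬ ∀ v ∈ e, v ∈ S} := by
    rintro ω ⟨v, w, hw, hm⟩
    have hlen : (w.mapLe offGraph_le).length = m := by rw [SimpleGraph.Walk.length_mapLe, hm]
    simp only [Set.mem_iUnion]
    refine ⟨⟨v, w.mapLe offGraph_le⟩, Finset.mem_filter.2 ⟨hF _ hlen, hlen⟩,
      (SimpleGraph.Walk.isPath_mapLe _).2 hw, fun e he => ?_⟩
    rw [SimpleGraph.Walk.edges_mapLe_eq_edges] at he
    exact of_mem_edgeSet_offGraph (w.edges_subset_edgeSet he)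
  calc percMeasure G S p q (farEvent G S m y)
      ≤ ∑ w ∈ F', percMeasure G S p q {ω | w.2.IsPath ∧ ∀ e ∈ w.2.edges,
          ∃ h : e ∈ G.edgeSet, ω ⟨e, h⟩ = true ∧ ¬ ∀ v ∈ e, v ∈ S} :=
        (measure_mono hsub).trans (measure_biUnion_finset_le _ _)
    _ ≤ ∑ w ∈ F', (toNNReal p : ℝ≥0∞) ^ m := by
        refine Finset.sum_le_sum fun w hw => ?_
        have := measure_openPath_le (S := S) p q w.2
        rwa [(Finset.mem_filter.1 hw).2] at this
    _ ≤ ((toNNReal p : ℝ≥0∞) * d) ^ m := by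
        rw [Finset.sum_const, nsmul_eq_mul, mul_pow, mul_comm]
        gcongr
        exact_mod_cast (Finset.card_filter_le _ _).trans hc

/-- An infinite cluster leaves every ball, so it contains paths of every length from `y`, an event
of probability at most `(pd)^m` for all `m`. -/
theorem ae_finite_offGraph_cluster [G.LocallyFinite] (hG : G.Connected) {d : ℕ}
    (hd : ∀ v, G.degree v ≤ d) (p q : I) (hp : (toNNReal p : ℝ≥0∞) * d < 1) :
    ∀ᵐ ω ∂percMeasure G S p q, ∀ y, {v | (offGraph G S ω).Reachable y v}.Finite := by
  have := countable_of_locallyFinite G hG hd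
  rw [ae_all_iff]
  intro y
  rw [ae_iff]
  have hsub : ∀ m, {ω | ¬ {v | (offGraph G S ω).Reachable y v}.Finite} ⊆ farEvent G S m y := by
    intro m ω hω
    have hω : {v | (offGraph G S ω).Reachable y v}.Infinite := hω
    obtain ⟨v, hv, hvm⟩ := (hω.sdiff (finite_ball G hG hd m y)).nonempty
    obtain ⟨w, hw⟩ := SimpleGraph.Reachable.exists_isPath hv
    have h1 : G.dist y v ≤ w.length := by
      simpa using G.dist_le (w.mapLe offGraph_le)
    have h2 : m < G.dist y v := not_le.1 hvm
    exact ⟨_, w.take m, hw.take m, by rw [SimpleGraph.Walk.take_length]; omega⟩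
  have htend := ENNReal.tendsto_pow_atTop_nhds_zero_of_lt_one hp
  exact le_antisymm (ge_of_tendsto' htend fun m =>
    (measure_mono (hsub m)).trans (measure_farEvent_le hd p q m y)) zero_le

/-- The part of an open path before its first visit of `S` uses no edge inside `S`. -/
theorem exists_offGraph_reachable {y s : V} (hs : s ∈ S) (h : (openGraph G ω).Reachable y s) :
    ∃ t ∈ S, (offGraph G S ω).Reachable y t := by
  obtain ⟨w⟩ := h
  induction w with
  | nil => exact ⟨_, hs, .refl _⟩
  | @cons x z _ h w ih =>
    by_cases hx : x ∈ S
    · exact ⟨x, hx, .refl _⟩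
    · obtain ⟨t, ht, hr⟩ := ih hs
      refine ⟨t, ht, SimpleGraph.Reachable.trans (SimpleGraph.Adj.reachable ?_) hr⟩
      exact ⟨h, fun h' => hx h'.1⟩

/-- If the edges of `H'` that are missing in `H` lie inside `B`, every point of an `H'`-cluster is
joined in `H` to the starting point or to a point of `B`. -/
theorem reachable_or_exists_reachable {H H' : SimpleGraph V} {B : Set V}
    (hH : ∀ x y, H'.Adj x y → H.Adj x y ∨ x ∈ B ∧ y ∈ B) {u y : V} (h : H'.Reachable u y) :
    H.Reachable u y ∨ ∃ b ∈ B, H'.Reachable u b ∧ H.Reachable b y := by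
  obtain ⟨w⟩ := h.symm
  induction w with
  | nil => exact .inl (.refl _)
  | @cons y z u hyz w ih =>
    have huz : H'.Reachable u z := ⟨w.reverse⟩
    rcases hH y z hyz with hHyz | hB
    · rcases ih huz with h | ⟨b, hb, hub, hbz⟩
      · exact .inl (h.trans hHyz.symm.reachable)
      · exact .inr ⟨b, hb, hub, hbz.trans hHyz.symm.reachable⟩
    · exact .inr ⟨y, hB.1, huz.trans hyz.symm.reachable, .refl _⟩

/-- The `H'`-cluster is covered by the `H`-clusters of `u` and of the finitely many points of `B` in
it, so one of these is infinite. -/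
theorem exists_infinite_of_infinite {H H' : SimpleGraph V} {B : Set V}
    (hH : ∀ x y, H'.Adj x y → H.Adj x y ∨ x ∈ B ∧ y ∈ B) {u : V}
    (hB : (B ∩ {b | H'.Reachable u b}).Finite) (hu : {v | H'.Reachable u v}.Infinite) :
    ∃ w, H'.Reachable u w ∧ {v | H.Reachable w v}.Infinite := by
  by_contra! hcon
  have hfin : ∀ w, H'.Reachable u w → {v | H.Reachable w v}.Finite := hcon
  refine hu (((hfin u (.refl _)).union (hB.biUnion fun b hb => hfin b hb.2)).subset fun y hy => ?_)
  rcases reachable_or_exists_reachable hH hy with h | ⟨b, hb, hub, hby⟩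
  · exact .inl h
  · exact .inr (Set.mem_biUnion ⟨hb, hub⟩ hby)

/-- If the clusters outside `S` are finite, every infinite cluster has infinitely many vertices
in `S`. -/
theorem infinite_cluster_inter (hfin : ∀ y, {v | (offGraph G S ω).Reachable y v}.Finite) {u : V}
    (hu : (cluster G ω u).Infinite) : (cluster G ω u ∩ S).Infinite := by
  intro h
  have hadj : ∀ x y, (openGraph G ω).Adj x y →
      (offGraph G S ω).Adj x y ∨ x ∈ S ∧ y ∈ S := fun x y h => by
    by_cases hS : x ∈ S ∧ y ∈ S
    · exact .inr hS
    · exact .inl ⟨h, hS⟩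
  rw [Set.inter_comm] at h
  obtain ⟨w, -, hw⟩ := exists_infinite_of_infinite hadj h hu
  exact hw (hfin w)

end RandomGraph

/-! ### Comparing distances in `G` and in the subgraph on `S` -/

section Geometry

variable {V : Type*} {G : SimpleGraph V} {S : Set V}

theorem dist_map_le {W : Type*} {H : SimpleGraph W} (φ : G →g H) {u v : V}
    (h : G.Reachable u v) : H.dist (φ u) (φ v) ≤ G.dist u v := by
  obtain ⟨w, hw⟩ := h.exists_walk_length_eq_dist
  rw [← hw, ← w.length_map φ]
  exact SimpleGraph.dist_le _

theorem dist_iso (hG : G.Connected) (g : G ≃g G) (u v : V) :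
    G.dist (g u) (g v) = G.dist u v := by
  refine le_antisymm (dist_map_le g.toHom (hG u v)) ?_
  simpa using dist_map_le g.symm.toHom (hG (g u) (g v))

/-- Distances in the homogeneous subgraph are bounded in terms of the distances in the graph. -/
theorem exists_induce_dist_bound [G.LocallyFinite] (hG : G.Connected) {d : ℕ}
    (hd : ∀ v, G.degree v ≤ d) {Γ : Subgroup (G ≃g G)} (hS : (G.induce S).Connected)
    (hΓ : RestrictionActsTransitively Γ S) (m : ℕ) :
    ∃ f, ∀ u v : S, G.dist (u : V) v ≤ m → (G.induce S).dist u v ≤ f := by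
  obtain ⟨o⟩ := hS.nonempty
  have hfin : {v : S | G.dist (o : V) v ≤ m}.Finite :=
    (finite_ball G hG hd m o).preimage Subtype.val_injective.injOn
  obtain ⟨f, hf⟩ := (hfin.image fun v => (G.induce S).dist o v).bddAbove
  refine ⟨f, fun u v huv => ?_⟩
  -- Transitivity moves `u` to the fixed point `o`, whose ball in `G` is finite; this makes the
  -- bound uniform.
  obtain ⟨g, hg, hgo⟩ := hΓ.2 o o.2 u u.2
  have hgS := hΓ.1 g hg
  obtain ⟨v', hv', hgv⟩ : (v : V) ∈ g '' S := by rw [hgS]; exact v.2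
  let φ : G.induce S →g G.induce S :=
    ⟨fun x => ⟨g x, hgS.subset (Set.mem_image_of_mem g x.2)⟩, fun h => g.map_adj_iff.2 h⟩
  have h1 : φ o = u := Subtype.ext hgo
  have h2 : φ ⟨v', hv'⟩ = v := Subtype.ext hgv
  rw [← h1, ← h2]
  refine (dist_map_le φ (hS _ _)).trans (hf ⟨⟨v', hv'⟩, ?_, rfl⟩)
  rw [Set.mem_ofPred_eq, ← dist_iso hG g, hgo, hgv]
  exact huv

theorem exists_interiorBoundary_dist_le {K : Set V} {k s : V} (w : G.Walk k s) (hk : k ∈ K)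
    (hs : s ∉ K) : ∃ x ∈ interiorBoundary G K, G.dist x s ≤ w.length := by
  induction w with
  | nil => exact absurd hk hs
  | @cons k z s h w ih =>
    by_cases hz : z ∈ K
    · obtain ⟨x, hx, hxs⟩ := ih hz hs
      exact ⟨x, hx, hxs.trans (by simp)⟩
    · exact ⟨k, ⟨hk, z, hz, h.symm⟩, SimpleGraph.dist_le (.cons h w)⟩

/-- A geodesic of the subgraph from `K` to `s ∉ K` leaves `K` through its interior boundary, so `s`
is within `f` of that boundary. -/
theorem exists_finset_near_complement [G.LocallyFinite] (hG : G.Connected) {d : ℕ}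
    (hd : ∀ v, G.degree v ≤ d) (hS : (G.induce S).Connected) {m f : ℕ}
    (hf : ∀ u v : S, G.dist (u : V) v ≤ m → (G.induce S).dist u v ≤ f) (K : Finset S) :
    ∃ T : Finset V, (∀ s : S, s ∉ K → ∀ k ∈ K, G.dist (k : V) s ≤ m → (s : V) ∈ T) ∧
      T.card ≤ (interiorBoundary (G.induce S) (K : Set S)).ncard *
        ∑ i ∈ Finset.range (f + 1), d ^ i := by
  classical
  have hfin : (interiorBoundary (G.induce S) (K : Set S)).Finite :=
    K.finite_toSet.subset fun x hx => hx.1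
  obtain ⟨T, hT, hc⟩ := exists_finset_ball G hG hd f (hfin.toFinset.image Subtype.val)
  refine ⟨T, fun s hs k hk hks => ?_, hc.trans (Nat.mul_le_mul_right _ ?_)⟩
  · obtain ⟨w, hw⟩ := hS.exists_walk_length_eq_dist k s
    obtain ⟨x, hx, hxs⟩ := exists_interiorBoundary_dist_le w (K := (K : Set S)) hk hs
    refine hT x (Finset.mem_image_of_mem _ (by simpa using hx)) s ?_
    have h1 := dist_map_le (SimpleGraph.Embedding.induce S).toHom (hS x s)
    have h2 := hf k s hks
    simp only [RelEmbedding.coe_toRelHom, SimpleGraph.Embedding.comap_apply,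
      Function.Embedding.coe_subtype] at h1
    omega
  · rw [Set.ncard_eq_toFinset_card _ hfin]
    exact Finset.card_image_le

end Geometry

/-! ### Sets with few boundary vertices connected to `S` -/

section SmallBoundary

variable {V : Type*} {G : SimpleGraph V} {S : Set V}

theorem expectedConnected_exteriorBoundary_le [G.LocallyFinite] (hG : G.Connected) {d : ℕ}
    (hd : ∀ v, G.degree v ≤ d) (hS : (G.induce S).Connected) (p q : I) {r f : ℕ}
    (hf : ∀ u v : S, G.dist (u : V) v ≤ 2 * r + 1 → (G.induce S).dist u v ≤ f) (K : Finset S)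
    (R : Finset V) (hR : ∀ v, v ∈ R ↔ ∃ k ∈ K, G.dist (k : V) v ≤ r) :
    expectedConnected G S p q (exteriorBoundary G (R : Set V)) ≤
      (((interiorBoundary (G.induce S) (K : Set S)).ncard *
        (∑ i ∈ Finset.range (f + 1), d ^ i) * (∑ i ∈ Finset.range (r + 1), d ^ i) : ℕ) : ℝ≥0∞) +
      K.card * ((toNNReal p : ℝ≥0∞) * (d : ℝ≥0∞) ^ 2) ^ (r + 1) := by
  classical
  obtain ⟨T₀, hT₀, hc₀⟩ := exists_finset_near_complement hG hd hS hf K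
  obtain ⟨T, hT, hcT⟩ := exists_finset_ball G hG hd r T₀
  obtain ⟨Y, hY, hcY⟩ := exists_finset_sphere G hG hd (r + 1) (K.image Subtype.val)
  set μ := percMeasure G S p q
  have hbd : ∀ y ∈ exteriorBoundary G (R : Set V),
      (∀ k ∈ K, r < G.dist (k : V) y) ∧ ∃ k ∈ K, G.dist (k : V) y = r + 1 := by
    rintro y ⟨hy, x, hx, hxy⟩
    have h1 : ∀ k ∈ K, r < G.dist (k : V) y := by
      intro k hk
      by_contra! h
      exact hy (Finset.mem_coe.2 ((hR y).2 ⟨k, hk, h⟩))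
    obtain ⟨k, hk, hkx⟩ := (hR x).1 (Finset.mem_coe.1 hx)
    refine ⟨h1, k, hk, ?_⟩
    have h2 := h1 k hk
    have h3 := hG.dist_triangle (u := (k : V)) (v := x) (w := y)
    have h4 := SimpleGraph.dist_eq_one_iff_adj.2 hxy
    omega
  -- Passing to the measurable hull keeps the probability and avoids proving `farEvent` measurable.
  have hpt : ∀ ω, ((connectedTo G ω (exteriorBoundary G (R : Set V)) S).encard : ℝ≥0∞) ≤
      (T.card : ℝ≥0∞) + ∑ y ∈ Y, (toMeasurable μ (farEvent G S (r + 1) y)).indicator 1 ω := by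
    intro ω
    have hsub : connectedTo G ω (exteriorBoundary G (R : Set V)) S ⊆
        ((T ∪ Y.filter fun y => ω ∈ farEvent G S (r + 1) y : Finset V) : Set V) := by
      rintro y ⟨hy, s, hs, hsy⟩
      obtain ⟨h1, k, hk, hky⟩ := hbd y hy
      obtain ⟨t, ht, hyt⟩ := exists_offGraph_reachable hs hsy.symm
      obtain ⟨w, hw⟩ := hyt.exists_isPath
      rw [Finset.mem_coe, Finset.mem_union]
      -- A long path is a far event. A short one ends at some `t ∈ S` within `r` of `y`, so outside
      -- `K` and within `(r + 1) + r` of it.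
      by_cases hlen : r + 1 ≤ w.length
      · right
        refine Finset.mem_filter.2 ⟨hY k (Finset.mem_image_of_mem _ hk) y hky, ?_⟩
        exact ⟨_, w.take (r + 1), hw.take _, by rw [SimpleGraph.Walk.take_length]; omega⟩
      · left
        have h2 : G.dist y t ≤ w.length := by
          simpa using G.dist_le (w.mapLe offGraph_le)
        have h2' : G.dist t y = G.dist y t := SimpleGraph.dist_comm
        have htK : (⟨t, ht⟩ : S) ∉ K := fun h => by
          have := h1 _ h
          simp only at this
          omega
        refine hT t (hT₀ ⟨t, ht⟩ htK k hk ?_) y (by omega)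
        have := hG.dist_triangle (u := (k : V)) (v := y) (w := t)
        simp only
        omega
    have h1 : (connectedTo G ω (exteriorBoundary G (R : Set V)) S).encard ≤
        ((T.card + (Y.filter fun y => ω ∈ farEvent G S (r + 1) y).card : ℕ) : ℕ∞) := by
      refine (Set.encard_le_encard hsub).trans ?_
      rw [Set.encard_coe_eq_coe_finsetCard]
      exact_mod_cast Finset.card_union_le _ _
    refine (ENat.toENNReal_le.2 h1).trans ?_
    rw [ENat.toENNReal_coe, Nat.cast_add]
    gcongr
    rw [Finset.card_filter, Nat.cast_sum]
    refine Finset.sum_le_sum fun y _ => ?_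
    by_cases hy : ω ∈ farEvent G S (r + 1) y
    · simp [hy, subset_toMeasurable μ _ hy]
    · simp [hy]
  calc expectedConnected G S p q (exteriorBoundary G (R : Set V))
      ≤ ∫⁻ ω, (T.card : ℝ≥0∞) +
          ∑ y ∈ Y, (toMeasurable μ (farEvent G S (r + 1) y)).indicator 1 ω ∂μ :=
        lintegral_mono hpt
    _ = T.card + ∑ y ∈ Y, μ (farEvent G S (r + 1) y) := by
        rw [lintegral_add_left measurable_const, lintegral_const, measure_univ, mul_one,
          lintegral_finsetSum]
        · congr 1
          refine Finset.sum_congr rfl fun y _ => ?_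
          rw [lintegral_indicator_one (measurableSet_toMeasurable _ _), measure_toMeasurable]
        · exact fun y _ => measurable_one.indicator (measurableSet_toMeasurable _ _)
    _ ≤ _ := by
        gcongr
        · exact hcT.trans (Nat.mul_le_mul_right _ hc₀)
        · refine (Finset.sum_le_sum fun y _ => measure_farEvent_le hd p q (r + 1) y).trans ?_
          rw [Finset.sum_const, nsmul_eq_mul]
          have h1 : (Y.card : ℝ≥0∞) ≤ K.card * (d : ℝ≥0∞) ^ (r + 1) := by
            exact_mod_cast hcY.trans (Nat.mul_le_mul_right _ Finset.card_image_le)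
          refine (mul_le_mul_left h1 _).trans (le_of_eq ?_)
          rw [mul_assoc, ← mul_pow]
          congr 2
          ring

/-- The radius is fixed first, to control long paths; `K` is then chosen against the constants
depending on that radius. The parameter `r₀` leaves room in `R` for translates of a finite region
based at points of `K`. -/
theorem exists_expectedConnected_le [G.LocallyFinite] (hG : G.Connected) {d : ℕ}
    (hd : ∀ v, G.degree v ≤ d) {Γ : Subgroup (G ≃g G)} (hS : (G.induce S).Connected)
    (hΓ : RestrictionActsTransitively Γ S) (hamen : IsAmenable (G.induce S)) (p q : I)
    (hp : (toNNReal p : ℝ≥0∞) * (d : ℝ≥0∞) ^ 2 < 1) {ε : ℝ} (hε : 0 < ε) (r₀ : ℕ) :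
    ∃ K R : Finset V, K.Nonempty ∧ (K : Set V) ⊆ S ∧
      (∀ k ∈ K, ∀ v, G.dist k v ≤ r₀ → v ∈ R) ∧
      expectedConnected G S p q (exteriorBoundary G (R : Set V)) ≤ ENNReal.ofReal ε * K.card := by
  classical
  obtain ⟨r, hr, hrε⟩ : ∃ r, r₀ ≤ r ∧
      ((toNNReal p : ℝ≥0∞) * (d : ℝ≥0∞) ^ 2) ^ (r + 1) ≤ ENNReal.ofReal (ε / 2) := by
    have h1 := (ENNReal.tendsto_pow_atTop_nhds_zero_of_lt_one hp).comp (tendsto_add_atTop_nat 1)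
    have h2 := h1.eventually (ge_mem_nhds (ENNReal.ofReal_pos.2 (half_pos hε)))
    obtain ⟨r, h3, h4⟩ := (h2.and (eventually_ge_atTop r₀)).exists
    exact ⟨r, h4, h3⟩
  obtain ⟨f, hf⟩ := exists_induce_dist_bound hG hd hS hΓ (2 * r + 1)
  set C : ℕ := (∑ i ∈ Finset.range (f + 1), d ^ i) * (∑ i ∈ Finset.range (r + 1), d ^ i) with hC
  obtain ⟨K, hK, hKb⟩ := hamen (ε / (2 * (C + 1))) (by positivity)
  have hfin : {v : V | ∃ k ∈ K, G.dist (k : V) v ≤ r}.Finite := by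
    refine (K.finite_toSet.biUnion fun k _ => finite_ball G hG hd r (k : V)).subset ?_
    rintro v ⟨k, hk, hv⟩
    exact Set.mem_biUnion hk hv
  refine ⟨K.image Subtype.val, hfin.toFinset, hK.image _, ?_, ?_, ?_⟩
  · intro x hx
    obtain ⟨k, -, rfl⟩ := Finset.mem_image.1 (Finset.mem_coe.1 hx)
    exact k.2
  · intro k hk v hv
    obtain ⟨k', hk', rfl⟩ := Finset.mem_image.1 hk
    exact hfin.mem_toFinset.2 ⟨k', hk', hv.trans hr⟩
  · refine (expectedConnected_exteriorBoundary_le hG hd hS p q hf K hfin.toFinset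
      (fun v => by simp)).trans ?_
    rw [Finset.card_image_of_injective _ Subtype.val_injective, mul_assoc, ← hC]
    have hsplit : ENNReal.ofReal ε = ENNReal.ofReal (ε / 2) + ENNReal.ofReal (ε / 2) := by
      rw [← ENNReal.ofReal_add (by positivity) (by positivity), add_halves]
    rw [hsplit, add_mul]
    refine add_le_add ?_ ?_
    · have h1 : (((interiorBoundary (G.induce S) (K : Set S)).ncard * C : ℕ) : ℝ) ≤
          ε / 2 * K.card := by
        push_cast
        have h2 : ε / (2 * (C + 1)) * C ≤ ε / 2 := by
          rw [div_mul_eq_mul_div, div_le_div_iff₀ (by positivity) (by positivity)]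
          nlinarith [Nat.cast_nonneg (α := ℝ) C]
        have h3 : (0 : ℝ) ≤ K.card := by positivity
        have h4 : (0 : ℝ) ≤ C := by positivity
        nlinarith [mul_le_mul_of_nonneg_right hKb h4, mul_le_mul_of_nonneg_right h2 h3]
      calc (((interiorBoundary (G.induce S) (K : Set S)).ncard * C : ℕ) : ℝ≥0∞)
          = ENNReal.ofReal (((interiorBoundary (G.induce S) (K : Set S)).ncard * C : ℕ) : ℝ) :=
            (ENNReal.ofReal_natCast _).symm
        _ ≤ ENNReal.ofReal (ε / 2 * K.card) := ENNReal.ofReal_le_ofReal h1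
        _ = ENNReal.ofReal (ε / 2) * K.card := by
            rw [ENNReal.ofReal_mul (by positivity), ENNReal.ofReal_natCast]
    · rw [mul_comm]
      gcongr

theorem exists_seq_tendsto_zero [G.LocallyFinite] (hG : G.Connected) {d : ℕ}
    (hd : ∀ v, G.degree v ≤ d) {Γ : Subgroup (G ≃g G)} (hS : (G.induce S).Connected)
    (hΓ : RestrictionActsTransitively Γ S) (hamen : IsAmenable (G.induce S)) (p q : I)
    (hp : (toNNReal p : ℝ≥0∞) * (d : ℝ≥0∞) ^ 2 < 1) :
    ∃ R : ℕ → Finset V, (∀ n, ((R n : Set V) ∩ S).Nonempty) ∧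
      Tendsto (fun n => expectedConnected G S p q (exteriorBoundary G (R n : Set V)) /
          (((R n : Set V) ∩ S).encard : ℝ≥0∞)) atTop (𝓝 0) := by
  choose K R hK hKS hKR hE using fun n : ℕ =>
    exists_expectedConnected_le hG hd hS hΓ hamen p q hp (Nat.one_div_pos_of_nat (α := ℝ) (n := n)) 0
  have hsub : ∀ n, (K n : Set V) ⊆ (R n : Set V) ∩ S := fun n k hk =>
    ⟨hKR n k hk k (by simp), hKS n hk⟩
  refine ⟨R, fun n => (Finset.coe_nonempty.2 (hK n)).mono (hsub n), ?_⟩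
  have hlim : Tendsto (fun n : ℕ => ENNReal.ofReal (1 / ((n : ℝ) + 1))) atTop (𝓝 0) := by
    rw [← ENNReal.ofReal_zero]
    exact ENNReal.tendsto_ofReal tendsto_one_div_add_atTop_nhds_zero_nat
  refine tendsto_of_tendsto_of_tendsto_of_le_of_le tendsto_const_nhds hlim (fun _ => zero_le)
    fun n => ENNReal.div_le_of_le_mul ((hE n).trans ?_)
  gcongr
  have := Set.encard_le_encard (hsub n)
  rw [Set.encard_coe_eq_coe_finsetCard] at this
  simpa using ENat.toENNReal_le.2 this

end SmallBoundary

/-! ### Invariance under automorphisms preserving `S` -/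

section Shift

variable {V : Type*} {G : SimpleGraph V} {S : Set V}

/-- The configuration seen through a graph automorphism. -/
def shift (g : G ≃g G) (ω : Config G) : Config G := fun e => ω (g.mapEdgeSet e)

theorem openGraph_shift_adj (g : G ≃g G) (ω : Config G) {x y : V} :
    (openGraph G (shift g ω)).Adj x y ↔ (openGraph G ω).Adj (g x) (g y) := by
  simp only [openGraph_adj]
  exact ⟨fun ⟨h, h'⟩ => ⟨g.map_adj_iff.2 h, h'⟩, fun ⟨h, h'⟩ => ⟨g.map_adj_iff.1 h, h'⟩⟩

/-- The automorphism as an isomorphism between the open graphs. -/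
def openGraphShiftIso (g : G ≃g G) (ω : Config G) : openGraph G (shift g ω) ≃g openGraph G ω :=
  ⟨g.toEquiv, (openGraph_shift_adj g ω).symm⟩

/-- The automorphism as an isomorphism between the open graphs outside a set and its image. -/
def avoidShiftIso (g : G ≃g G) (ω : Config G) (B : Set V) :
    avoid (openGraph G (shift g ω)) B ≃g avoid (openGraph G ω) (g '' B) :=
  ⟨g.toEquiv, fun {x y} => by
    change ((openGraph G ω).Adj (g x) (g y) ∧ g x ∉ g '' B ∧ g y ∉ g '' B) ↔ _
    rw [g.injective.mem_set_image, g.injective.mem_set_image, ← openGraph_shift_adj]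
    rfl⟩

theorem edgeProb_mapEdgeSet (g : G ≃g G) (hg : g '' S = S) (p q : I) (e : G.edgeSet) :
    edgeProb G S p q (g.mapEdgeSet e) = edgeProb G S p q e := by
  have hmem : ∀ x, g x ∈ S ↔ x ∈ S := fun x => by
    conv_lhs => rw [← hg]
    exact g.injective.mem_set_image
  obtain ⟨e, he⟩ := e
  have : (∀ v ∈ ((g.mapEdgeSet ⟨e, he⟩ : G.edgeSet) : Sym2 V), v ∈ S) ↔ ∀ v ∈ e, v ∈ S := by
    change (∀ v ∈ e.map g, v ∈ S) ↔ _
    simp [Sym2.mem_map, hmem]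
  unfold edgeProb
  split_ifs <;> tauto

theorem map_shift_percMeasure (g : G ≃g G) (hg : g '' S = S) (p q : I) :
    (percMeasure G S p q).map (shift g) = percMeasure G S p q :=
  map_precomp_bitMeasure _ g.mapEdgeSet (edgeProb_mapEdgeSet g hg p q)

theorem measurable_shift (g : G ≃g G) : Measurable (shift g) := by
  unfold shift
  fun_prop

end Shift

/-! ### Trifurcations have probability zero -/

section TrifurcationEvent

variable {V : Type*} {G : SimpleGraph V} {S : Set V}

/-- All edges inside `B` are open, and three different infinite components remain attached to `B`
when the vertices of `B` are deleted. -/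
def trifEvent (G : SimpleGraph V) (B : Set V) : Set (Config G) :=
  {ω | (∀ x ∈ B, ∀ y ∈ B, G.Adj x y → (openGraph G ω).Adj x y) ∧
    ∃ z : Fin 3 → V, (∀ a, z a ∉ B ∧ (∃ b ∈ B, (openGraph G ω).Adj (z a) b) ∧
      {v | (avoid (openGraph G ω) B).Reachable (z a) v}.Infinite) ∧
      ∀ a b, a ≠ b → ¬ (avoid (openGraph G ω) B).Reachable (z a) (z b)}

theorem measurableSet_trifEvent [Countable V] (B : Set V) : MeasurableSet (trifEvent G B) := by
  have hadj : ∀ x y, MeasurableSet {ω : Config G | (avoid (openGraph G ω) B).Adj x y} := by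
    intro x y
    have : {ω : Config G | (avoid (openGraph G ω) B).Adj x y} =
        {ω | (openGraph G ω).Adj x y} ∩ {_ω | x ∉ B ∧ y ∉ B} := rfl
    rw [this]
    exact (measurableSet_openGraph_adj x y).inter (.const _)
  have h1 := fun x y => measurableSet_setOfPred.1 (measurableSet_openGraph_adj (G := G) x y)
  have h2 := fun u v => measurableSet_setOfPred.1 (measurableSet_reachable _ hadj u v)
  have h3 := fun u => measurableSet_setOfPred.1 (measurableSet_infinite _ hadj u)
  refine measurableSet_setOfPred.2 (Measurable.and ?_ ?_)
  · exact .forall fun x => .forall fun _ => .forall fun y => .forall fun _ => .forall fun _ => h1 x y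
  · refine .exists fun z => Measurable.and (.forall fun a => ?_) ?_
    · exact measurable_const.and (Measurable.and
        (.exists fun b => measurable_const.and (h1 _ b)) (h3 _))
    · exact .forall fun a => .forall fun b => .forall fun _ => (h2 _ _).not

theorem shift_preimage_trifEvent_subset (g : G ≃g G) (B : Set V) :
    shift g ⁻¹' trifEvent G B ⊆ trifEvent G (g '' B) := by
  rintro ω ⟨hopen, z, hz, hzz⟩
  have hr : ∀ u v, (avoid (openGraph G ω) (g '' B)).Reachable (g u) (g v) ↔
      (avoid (openGraph G (shift g ω)) B).Reachable u v := fun u v =>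
    SimpleGraph.Iso.reachable_iff (φ := avoidShiftIso g ω B)
  refine ⟨?_, fun a => g (z a), fun a => ⟨?_, ?_, ?_⟩, fun a b hab => ?_⟩
  · rintro _ ⟨x, hx, rfl⟩ _ ⟨y, hy, rfl⟩ hxy
    exact (openGraph_shift_adj g ω).1 (hopen x hx y hy (g.map_adj_iff.1 hxy))
  · rw [g.injective.mem_set_image]
    exact (hz a).1
  · obtain ⟨b, hb, hzb⟩ := (hz a).2.1
    exact ⟨g b, Set.mem_image_of_mem g hb, (openGraph_shift_adj g ω).1 hzb⟩
  · refine ((hz a).2.2.image g.injective.injOn).mono ?_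
    rintro _ ⟨v, hv, rfl⟩
    exact (hr _ _).2 hv
  · rw [hr]
    exact hzz a b hab

theorem measure_trifEvent_le_image [Countable V] (g : G ≃g G) (hg : g '' S = S) (p q : I)
    (B : Set V) :
    percMeasure G S p q (trifEvent G B) ≤ percMeasure G S p q (trifEvent G (g '' B)) := by
  conv_lhs => rw [← map_shift_percMeasure g hg p q]
  rw [Measure.map_apply (measurable_shift g) (measurableSet_trifEvent B)]
  exact measure_mono (shift_preimage_trifEvent_subset g B)

theorem exists_exteriorBoundary_reachable {H : SimpleGraph V} (hH : H ≤ G) {R : Set V} {z v : V}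
    (h : H.Reachable z v) (hz : z ∈ R) (hv : v ∉ R) :
    ∃ y ∈ exteriorBoundary G R, H.Reachable z y := by
  obtain ⟨w⟩ := h
  induction w with
  | nil => exact absurd hz hv
  | @cons z x v hzx w ih =>
    by_cases hx : x ∈ R
    · obtain ⟨y, hy, hr⟩ := ih hx hv
      exact ⟨y, hy, hzx.reachable.trans hr⟩
    · exact ⟨x, ⟨hx, z, hz, hH hzx⟩, hzx.reachable⟩

theorem finite_exteriorBoundary [G.LocallyFinite] (R : Finset V) :
    (exteriorBoundary G (R : Set V)).Finite := by
  refine (R.finite_toSet.biUnion fun x _ => (G.neighborSet x).toFinite).subset ?_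
  rintro y ⟨-, x, hx, hxy⟩
  exact Set.mem_biUnion hx hxy

/-- An infinite branch must leave the finite set `R`, and its exit vertex is connected to `S`
through `b`. -/
theorem exists_attached_mem_connectedTo {ω : Config G} {B : Set V} (hBS : B ⊆ S) {R : Finset V}
    (hBR : B ⊆ R) {z b : V} (hz : z ∉ B) (hb : b ∈ B) (hzb : (openGraph G ω).Adj z b)
    (hinf : {v | (avoid (openGraph G ω) B).Reachable z v}.Infinite) :
    ∃ y ∈ connectedTo G ω (exteriorBoundary G (R : Set V)) S,
      Attached (openGraph G ω) B y ∧ (avoid (openGraph G ω) B).Reachable z y := by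
  obtain ⟨y, hy, hr⟩ : ∃ y ∈ exteriorBoundary G (R : Set V),
      (avoid (openGraph G ω) B).Reachable z y := by
    obtain ⟨v, hv, hvR⟩ := hinf.exists_notMem_finset R
    by_cases hzR : z ∈ R
    · exact exists_exteriorBoundary_reachable (avoid_le.trans openGraph_le) hv
        (Finset.mem_coe.2 hzR) hvR
    · exact ⟨z, ⟨hzR, b, hBR hb, (openGraph_le hzb).symm⟩, .refl _⟩
  refine ⟨y, ⟨hy, b, hBS hb, hzb.symm.reachable.trans (hr.mono avoid_le)⟩,
    ⟨notMem_of_avoid_reachable hr hz, z, b, hb, hz, hzb, hr.symm⟩, hr⟩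

/-- Disjoint translates of a set at which trifurcations occur force as many connections
to the boundary. -/
theorem card_le_encard_connectedTo [G.LocallyFinite] {ω : Config G} {B : Set V}
    (hB : (G.induce B).Connected) (g : V → G ≃g G) (J : Finset V) (R : Finset V)
    (hS : ∀ x ∈ J, g x '' B ⊆ S) (hR : ∀ x ∈ J, g x '' B ⊆ R)
    (hdisj : ∀ x ∈ J, ∀ y ∈ J, x ≠ y → Disjoint (g x '' B) (g y '' B))
    (hω : ∀ x ∈ J, ω ∈ trifEvent G (g x '' B)) :
    (J.card : ℕ∞) ≤ (connectedTo G ω (exteriorBoundary G (R : Set V)) S).encard := by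
  classical
  have hfin : (connectedTo G ω (exteriorBoundary G (R : Set V)) S).Finite :=
    (finite_exteriorBoundary R).subset fun y hy => hy.1
  rw [hfin.encard_eq_coe_toFinset_card, Nat.cast_le]
  refine card_le_of_trifurcations (H := openGraph G ω) (B := fun x => g x '' B) hdisj ?_ ?_
  · rintro i hi j hj hij _ ⟨x, hx, rfl⟩ _ ⟨y, hy, rfl⟩
    have hd := Set.disjoint_left.1 (hdisj i hi j hj hij)
    -- All edges inside a trifurcation region are open, so each region stays connected after
    -- another, disjoint one is deleted.
    let φ : G.induce B →g avoid (openGraph G ω) (g j '' B) :=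
      ⟨fun v => g i v, fun {u v} h => ⟨(hω i hi).1 _ (Set.mem_image_of_mem _ u.2) _
        (Set.mem_image_of_mem _ v.2) ((g i).map_adj_iff.2 h),
        hd (Set.mem_image_of_mem _ u.2), hd (Set.mem_image_of_mem _ v.2)⟩⟩
    exact (hB.preconnected ⟨x, hx⟩ ⟨y, hy⟩).map φ
  · intro i hi
    obtain ⟨-, z, hz, hzz⟩ := hω i hi
    have hex : ∀ a, ∃ y ∈ connectedTo G ω (exteriorBoundary G (R : Set V)) S,
        Attached (openGraph G ω) (g i '' B) y ∧
        (avoid (openGraph G ω) (g i '' B)).Reachable (z a) y := by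
      intro a
      obtain ⟨h1, ⟨b, hb, hzb⟩, h3⟩ := hz a
      exact exists_attached_mem_connectedTo (hS i hi) (hR i hi) h1 hb hzb h3
    choose y hy hatt hr using hex
    refine ⟨y, fun a => ⟨by simpa using hy a, hatt a⟩, fun a b hab h => hzz a b hab ?_⟩
    exact (hr a).trans (h.trans (hr b).symm)

/-- For a separated subset of maximal size, the balls of radius `m` around its points cover `K`. -/
theorem exists_separated_subset [G.LocallyFinite] (hG : G.Connected) {d : ℕ}
    (hd : ∀ v, G.degree v ≤ d) (m : ℕ) (K : Finset V) :
    ∃ J ⊆ K, (∀ x ∈ J, ∀ y ∈ J, x ≠ y → m < G.dist x y) ∧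
      K.card ≤ J.card * ∑ i ∈ Finset.range (m + 1), d ^ i := by
  classical
  let sep : Finset V → Prop := fun J => ∀ x ∈ J, ∀ y ∈ J, x ≠ y → m < G.dist x y
  set P := K.powerset.filter sep
  obtain ⟨J, hJ, hmax⟩ := P.exists_max_image Finset.card ⟨∅, by simp [P, sep]⟩
  obtain ⟨hJK, hsep⟩ := Finset.mem_filter.1 hJ
  rw [Finset.mem_powerset] at hJK
  refine ⟨J, hJK, hsep, ?_⟩
  obtain ⟨F, hF, hc⟩ := exists_finset_ball G hG hd m J
  refine (Finset.card_le_card fun k hk => ?_).trans hc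
  by_contra hkF
  have hfar : ∀ x ∈ J, m < G.dist x k := by
    intro x hx
    by_contra! h
    exact hkF (hF x hx k h)
  have hkJ : k ∉ J := fun h => by simpa using hfar k h
  have := hmax (insert k J) (Finset.mem_filter.2 ⟨Finset.mem_powerset.2
    (Finset.insert_subset hk hJK), ?_⟩)
  · rw [Finset.card_insert_of_notMem hkJ] at this
    omega
  · intro x hx y hy hxy
    rcases Finset.mem_insert.1 hx with rfl | hx' <;> rcases Finset.mem_insert.1 hy with rfl | hy'
    · exact absurd rfl hxy
    · rw [SimpleGraph.dist_comm]
      exact hfar y hy'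
    · exact hfar x hx'
    · exact hsep x hx' y hy' hxy

/-- Translates of `B` to a separated subset of `K` are disjoint and lie in `R`. The expected number
of trifurcations among them is proportional to `|K|`, yet bounded by the expected number of boundary
connections. -/
theorem measure_trifEvent_eq_zero [G.LocallyFinite] (hG : G.Connected) {d : ℕ}
    (hd : ∀ v, G.degree v ≤ d) {Γ : Subgroup (G ≃g G)} (hS : (G.induce S).Connected)
    (hΓ : RestrictionActsTransitively Γ S) (hamen : IsAmenable (G.induce S)) (p q : I)
    (hp : (toNNReal p : ℝ≥0∞) * (d : ℝ≥0∞) ^ 2 < 1) {B : Set V} (hBfin : B.Finite)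
    (hBS : B ⊆ S) (hB : (G.induce B).Connected) :
    percMeasure G S p q (trifEvent G B) = 0 := by
  classical
  have := countable_of_locallyFinite G hG hd
  by_contra hpos
  set μ := percMeasure G S p q
  set δ := μ (trifEvent G B) with hδ
  have hδtop : δ ≠ ∞ := measure_ne_top _ _
  have hδ0 : 0 < δ.toReal := ENNReal.toReal_pos hpos hδtop
  obtain ⟨o, ho⟩ := hB.nonempty
  obtain ⟨ρ, hρ⟩ : ∃ ρ, ∀ b ∈ B, G.dist o b ≤ ρ := by
    obtain ⟨ρ, hρ⟩ := (hBfin.image fun b => G.dist o b).bddAbove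
    exact ⟨ρ, fun b hb => hρ ⟨b, hb, rfl⟩⟩
  set c : ℕ := ∑ i ∈ Finset.range (2 * ρ + 1), d ^ i with hc
  -- With `|K| ≤ c |J|`, the factor `δ / (c + 1)` forces `(c + 1) |J| ≤ |K| ≤ c |J|`, which is
  -- absurd.
  obtain ⟨K, R, hK, hKS, hKR, hE⟩ := exists_expectedConnected_le hG hd hS hΓ hamen p q hp
    (show 0 < δ.toReal / (c + 1) by positivity) ρ
  obtain ⟨J, hJK, hsep, hJc⟩ := exists_separated_subset hG hd (2 * ρ) K
  have hg : ∀ x, ∃ g : G ≃g G, x ∈ J → g '' S = S ∧ g o = x := by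
    intro x
    by_cases hx : x ∈ J
    · obtain ⟨g, hg, hgx⟩ := hΓ.2 o (hBS ho) x (hKS (hJK hx))
      exact ⟨g, fun _ => ⟨hΓ.1 g hg, hgx⟩⟩
    · exact ⟨SimpleGraph.Iso.refl, fun h => absurd h hx⟩
  choose g hg using hg
  have hball : ∀ x ∈ J, ∀ y ∈ g x '' B, G.dist x y ≤ ρ := by
    rintro x hx _ ⟨b, hb, rfl⟩
    have h := dist_iso hG (g x) o b
    rw [(hg x hx).2] at h
    exact h.trans_le (hρ b hb)
  have hpt : ∀ ω, ∑ x ∈ J, (trifEvent G (g x '' B)).indicator 1 ω ≤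
      ((connectedTo G ω (exteriorBoundary G (R : Set V)) S).encard : ℝ≥0∞) := by
    intro ω
    have h := card_le_encard_connectedTo (ω := ω) (S := S) hB g
      (J.filter fun x => ω ∈ trifEvent G (g x '' B)) R ?_ ?_ ?_ ?_
    · refine le_trans (le_of_eq ?_) (ENat.toENNReal_le.2 h)
      rw [ENat.toENNReal_coe, Finset.card_filter, Nat.cast_sum]
      refine Finset.sum_congr rfl fun x _ => ?_
      by_cases hx : ω ∈ trifEvent G (g x '' B) <;> simp [hx]
    · intro x hx
      rw [← (hg x (Finset.mem_filter.1 hx).1).1]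
      exact Set.image_mono hBS
    · intro x hx y hy
      have hx := (Finset.mem_filter.1 hx).1
      exact hKR x (hJK hx) y (hball x hx y hy)
    · intro x hx y hy hxy
      have hx := (Finset.mem_filter.1 hx).1
      have hy := (Finset.mem_filter.1 hy).1
      rw [Set.disjoint_left]
      intro v hvx hvy
      have h1 := hball x hx v hvx
      have h2 := hball y hy v hvy
      have h3 := hsep x hx y hy hxy
      have h4 := hG.dist_triangle (u := x) (v := v) (w := y)
      rw [SimpleGraph.dist_comm (u := v)] at h4
      omega
    · exact fun x hx => (Finset.mem_filter.1 hx).2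
  have hlow : (J.card : ℝ≥0∞) * δ ≤ expectedConnected G S p q (exteriorBoundary G (R : Set V)) := by
    refine le_trans ?_ (lintegral_mono hpt)
    rw [lintegral_finsetSum _ fun x _ => measurable_one.indicator (measurableSet_trifEvent _),
      ← nsmul_eq_mul, ← Finset.sum_const]
    refine Finset.sum_le_sum fun x hx => ?_
    rw [lintegral_indicator_one (measurableSet_trifEvent _)]
    exact measure_trifEvent_le_image (g x) (hg x hx).1 p q B
  have h1 := hlow.trans hE
  have h2 : (J.card : ℝ) * δ.toReal ≤ δ.toReal / (c + 1) * K.card := by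
    have := ENNReal.toReal_mono (ENNReal.mul_ne_top ENNReal.ofReal_ne_top
      (ENNReal.natCast_ne_top _)) h1
    rwa [ENNReal.toReal_mul, ENNReal.toReal_mul, ENNReal.toReal_natCast, ENNReal.toReal_natCast,
      ENNReal.toReal_ofReal (by positivity)] at this
  have h3 : (K.card : ℝ) ≤ J.card * c := by exact_mod_cast hJc
  have h4 : (0 : ℝ) < K.card := by exact_mod_cast hK.card_pos
  have h5 : (0 : ℝ) < c + 1 := by positivity
  have h6 : (J.card : ℝ) * (c + 1) ≤ K.card := by
    rw [div_mul_eq_mul_div, le_div_iff₀ h5] at h2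
    nlinarith
  have h7 : (J.card : ℝ) ≤ 0 := by nlinarith
  nlinarith [Nat.cast_nonneg (α := ℝ) c]

end TrifurcationEvent

/-! ### Opening all edges inside a finite subset of `S` -/

section Insertion

variable {V : Type*} {G : SimpleGraph V} {S : Set V}

open Classical in
/-- The edges of `G` with both endpoints in `B`. -/
noncomputable def edgesIn (G : SimpleGraph V) (B : Finset V) : Finset G.edgeSet :=
  B.sym2.subtype (· ∈ G.edgeSet)

theorem mem_edgesIn {B : Finset V} {e : G.edgeSet} :
    e ∈ edgesIn G B ↔ ∀ v ∈ (e : Sym2 V), v ∈ B := by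
  simp [edgesIn, Finset.mem_sym2_iff]

open Classical in
/-- The configuration with all edges inside `B` opened. -/
noncomputable def openInside (B : Finset V) (ω : Config G) : Config G := openOn (edgesIn G B) ω

theorem openInside_eq_true {B : Finset V} {ω : Config G} {e : G.edgeSet} :
    openInside B ω e = true ↔ ω e = true ∨ ∀ v ∈ (e : Sym2 V), v ∈ B := by
  rw [← mem_edgesIn]
  unfold openInside openOn
  split_ifs with h <;> simp [h]

theorem openGraph_openInside_adj {B : Finset V} {ω : Config G} {x y : V} :
    (openGraph G (openInside B ω)).Adj x y ↔
      (openGraph G ω).Adj x y ∨ G.Adj x y ∧ x ∈ B ∧ y ∈ B := by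
  simp only [openGraph_adj, openInside_eq_true, Sym2.mem_iff, forall_eq_or_imp, forall_eq]
  constructor
  · rintro ⟨h, h' | hB⟩
    · exact .inl ⟨h, h'⟩
    · exact .inr ⟨h, hB⟩
  · rintro (⟨h, h'⟩ | ⟨h, hB⟩)
    · exact ⟨h, .inl h'⟩
    · exact ⟨h, .inr hB⟩

theorem openGraph_le_openInside (B : Finset V) (ω : Config G) :
    openGraph G ω ≤ openGraph G (openInside B ω) :=
  fun _ _ h => openGraph_openInside_adj.2 (.inl h)

/-- Insertion tolerance as it is used below: the opened edges lie inside `S` and have parameter `q ≠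
0`. -/
theorem measure_eq_zero_of_subset_preimage_openInside {B : Finset V} (hBS : (B : Set V) ⊆ S)
    (p q : I) (hq : q ≠ 0) {D E : Set (Config G)} (hDE : D ⊆ openInside B ⁻¹' E)
    (hE : percMeasure G S p q E = 0) : percMeasure G S p q D = 0 := by
  classical
  have hac : (percMeasure G S p q).map (openInside B) ≪ percMeasure G S p q := by
    unfold openInside
    refine map_openOn_absolutelyContinuous (edgeProb G S p q) (edgesIn G B) fun i hi => ?_
    rwa [edgeProb, if_pos fun v hv => hBS (mem_edgesIn.1 hi v hv)]
  have hm : Measurable (openInside (G := G) B) := by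
    unfold openInside
    exact measurable_openOn (edgesIn G B)
  exact measure_mono_null hDE
    (le_antisymm ((Measure.le_map_apply hm.aemeasurable E).trans (hac hE).le) zero_le)

theorem exists_connected_finset (hS : (G.induce S).Connected) (u₀ u₁ u₂ : S) :
    ∃ B : Finset V, (B : Set V) ⊆ S ∧ (u₀ : V) ∈ B ∧ (u₁ : V) ∈ B ∧ (u₂ : V) ∈ B ∧
      (G.induce (B : Set V)).Connected := by
  classical
  obtain ⟨w₁⟩ := hS.preconnected u₀ u₁
  obtain ⟨w₂⟩ := hS.preconnected u₁ u₂
  let φ : G.induce S →g G := (SimpleGraph.Embedding.induce S).toHom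
  set w := (w₁.append w₂).map φ with hw
  refine ⟨w.support.toFinset, ?_, ?_, ?_, ?_, ?_⟩
  · intro x hx
    rw [Finset.mem_coe, List.mem_toFinset, hw, SimpleGraph.Walk.support_map, List.mem_map] at hx
    obtain ⟨s, -, rfl⟩ := hx
    exact s.2
  · exact List.mem_toFinset.2 w.start_mem_support
  · rw [List.mem_toFinset, hw, SimpleGraph.Walk.support_map]
    exact List.mem_map.2 ⟨u₁, by simp [SimpleGraph.Walk.mem_support_append_iff], rfl⟩
  · exact List.mem_toFinset.2 w.end_mem_support
  · have : ((w.support.toFinset : Finset V) : Set V) = {v | v ∈ w.support} := by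
      ext; simp
    rw [this]
    exact w.connected_induce_support

end Insertion

/-! ### At most two infinite clusters, then at most one -/

section Clusters

variable {V : Type*} {G : SimpleGraph V} {S : Set V}

/-- The given vertices lie in different infinite clusters. -/
def separatedInfinite (G : SimpleGraph V) {n : ℕ} (u : Fin n → V) : Set (Config G) :=
  {ω | (∀ a, (cluster G ω (u a)).Infinite) ∧
    ∀ a b, a ≠ b → ¬ (openGraph G ω).Reachable (u a) (u b)}

theorem measurableSet_separatedInfinite [Countable V] {n : ℕ} (u : Fin n → V) :
    MeasurableSet (separatedInfinite G u) := by
  have h1 := fun u v => measurableSet_setOfPred.1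
    (measurableSet_reachable _ (measurableSet_openGraph_adj (G := G)) u v)
  have h2 := fun u => measurableSet_setOfPred.1
    (measurableSet_infinite _ (measurableSet_openGraph_adj (G := G)) u)
  exact measurableSet_setOfPred.2 (Measurable.and (.forall fun a => h2 _)
    (.forall fun a => .forall fun b => .forall fun _ => (h1 _ _).not))

theorem cluster_eq_of_reachable {ω : Config G} {u v : V} (h : (openGraph G ω).Reachable u v) :
    cluster G ω u = cluster G ω v :=
  Set.ext fun _ => ⟨fun h' => h.symm.trans h', fun h' => h.trans h'⟩

theorem exists_separatedInfinite_mem {ω : Config G}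
    (hfin : ∀ y, {v | (offGraph G S ω).Reachable y v}.Finite) {n : ℕ} {u : Fin n → V}
    (hu : ω ∈ separatedInfinite G u) :
    ∃ s : Fin n → V, (∀ a, s a ∈ S) ∧ ω ∈ separatedInfinite G s := by
  choose s hs using fun a => (infinite_cluster_inter hfin (hu.1 a)).nonempty
  refine ⟨s, fun a => (hs a).2, fun a => ?_, fun a b hab h => hu.2 a b hab ?_⟩
  · rw [← cluster_eq_of_reachable (hs a).1]
    exact hu.1 a
  · exact (hs a).1.trans (h.trans (hs b).1.symm)

theorem shift_mem_separatedInfinite (g : G ≃g G) {ω : Config G} {n : ℕ} {u : Fin n → V} :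
    shift g ω ∈ separatedInfinite G u ↔ ω ∈ separatedInfinite G fun a => g (u a) := by
  have hr : ∀ u v, (openGraph G ω).Reachable (g u) (g v) ↔
      (openGraph G (shift g ω)).Reachable u v := fun u v =>
    SimpleGraph.Iso.reachable_iff (φ := openGraphShiftIso g ω)
  have hc : ∀ u, cluster G ω (g u) = g '' cluster G (shift g ω) u := by
    intro u
    ext v
    obtain ⟨v, rfl⟩ := g.surjective v
    rw [g.injective.mem_set_image]
    exact hr u v
  simp only [separatedInfinite, Set.mem_ofPred_eq, hr, hc,
    Set.infinite_image_iff g.injective.injOn]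

/-- Off `B`, the cluster splits into components of neighbours of `B`. Local finiteness leaves
finitely many, so one is infinite. -/
theorem exists_infinite_branch [G.LocallyFinite] {H : SimpleGraph V} (hH : H ≤ G) {B : Finset V}
    {u : V} (hu : u ∈ B) (hinf : {v | H.Reachable u v}.Infinite) :
    ∃ z ∉ (B : Set V), (∃ b ∈ (B : Set V), H.Adj z b) ∧ H.Reachable u z ∧
      {v | (avoid H (B : Set V)).Reachable z v}.Infinite := by
  set N : Set V := {z | z ∉ (B : Set V) ∧ H.Reachable u z ∧ ∃ b ∈ (B : Set V), H.Adj z b} with hN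
  have hNfin : N.Finite := by
    refine (B.finite_toSet.biUnion fun b _ => (G.neighborSet b).toFinite).subset ?_
    rintro z ⟨-, -, b, hb, hzb⟩
    exact Set.mem_biUnion hb (hH hzb.symm)
  have hcover : ∀ v, H.Reachable v u →
      v ∈ (B : Set V) ∨ ∃ z ∈ N, (avoid H (B : Set V)).Reachable z v := by
    rintro v ⟨w⟩
    induction w with
    | nil => exact .inl hu
    | @cons v x u hvx w ih =>
      by_cases hv : v ∈ (B : Set V)
      · exact .inl hv
      right
      rcases ih hu hinf hN hNfin with hx | ⟨z, hz, hzx⟩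
      · exact ⟨v, ⟨hv, (hvx.reachable.trans ⟨w⟩).symm, x, hx, hvx⟩, .refl _⟩
      · refine ⟨z, hz, hzx.trans (SimpleGraph.Adj.reachable ?_)⟩
        exact ⟨hvx.symm, notMem_of_avoid_reachable hzx hz.1, hv⟩
  by_contra! hcon
  refine hinf ((B.finite_toSet.union (hNfin.biUnion fun z hz =>
    hcon z hz.1 hz.2.2 hz.2.1)).subset fun v hv => ?_)
  rcases hcover v hv.symm with h | ⟨z, hz, hzv⟩
  · exact .inl h
  · exact .inr (Set.mem_biUnion hz hzv)

/-- Opening edges inside `B` does not change the graph off `B`, where branches of different original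
clusters remain separate. -/
theorem openInside_mem_trifEvent [G.LocallyFinite] {B : Finset V} {u : Fin 3 → V}
    (hu : ∀ a, u a ∈ B) {ω : Config G} (hω : ω ∈ separatedInfinite G u) :
    openInside B ω ∈ trifEvent G (B : Set V) := by
  have havoid : avoid (openGraph G (openInside B ω)) (B : Set V) =
      avoid (openGraph G ω) (B : Set V) := by
    ext x y
    simp only [avoid, openGraph_openInside_adj, Finset.mem_coe]
    tauto
  choose z hzB hzb huz hzinf using fun a => exists_infinite_branch openGraph_le (hu a) (hω.1 a)
  refine ⟨fun x hx y hy hxy => openGraph_openInside_adj.2 (.inr ⟨hxy, hx, hy⟩), z, fun a =>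
    ⟨hzB a, ?_, ?_⟩, fun a b hab h => hω.2 a b hab ?_⟩
  · obtain ⟨b, hb, h⟩ := hzb a
    exact ⟨b, hb, openGraph_le_openInside B ω h⟩
  · rw [havoid]
    exact hzinf a
  · rw [havoid] at h
    exact (huz a).trans ((h.mono avoid_le).trans (huz b).symm)

theorem ae_forall_notMem_separatedInfinite_three [G.LocallyFinite] (hG : G.Connected) {d : ℕ}
    (hd : ∀ v, G.degree v ≤ d) {Γ : Subgroup (G ≃g G)} (hS : (G.induce S).Connected)
    (hΓ : RestrictionActsTransitively Γ S) (hamen : IsAmenable (G.induce S)) (p q : I)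
    (hq : q ≠ 0) (hp : (toNNReal p : ℝ≥0∞) * (d : ℝ≥0∞) ^ 2 < 1)
    (hfin : ∀ᵐ ω ∂percMeasure G S p q, ∀ y, {v | (offGraph G S ω).Reachable y v}.Finite) :
    ∀ᵐ ω ∂percMeasure G S p q, ∀ u : Fin 3 → V, ω ∉ separatedInfinite G u := by
  have := countable_of_locallyFinite G hG hd
  have h : ∀ᵐ ω ∂percMeasure G S p q, ∀ u : Fin 3 → V, (∀ a, u a ∈ S) →
      ω ∉ separatedInfinite G u := by
    refine ae_all_iff.2 fun u => ?_
    by_cases hu : ∀ a, u a ∈ S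
    · obtain ⟨B, hBS, h0, h1, h2, hB⟩ :=
        exists_connected_finset hS ⟨u 0, hu 0⟩ ⟨u 1, hu 1⟩ ⟨u 2, hu 2⟩
      have huB : ∀ a, u a ∈ B := by
        intro a
        fin_cases a
        exacts [h0, h1, h2]
      have h0 := measure_eq_zero_of_subset_preimage_openInside hBS p q hq
        (E := trifEvent G (B : Set V)) (fun ω hω => openInside_mem_trifEvent huB hω)
        (measure_trifEvent_eq_zero hG hd hS hΓ hamen p q hp B.finite_toSet hBS hB)
      filter_upwards [measure_eq_zero_iff_ae_notMem.1 h0] with ω hω _ using hω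
    · exact ae_of_all _ fun ω h => absurd h hu
  filter_upwards [h, hfin] with ω h1 h2 u hu
  obtain ⟨s, hs, hsω⟩ := exists_separatedInfinite_mem h2 hu
  exact h1 s hs hsω

/-- There are at least two infinite clusters. -/
def twoInfinite (G : SimpleGraph V) : Set (Config G) := ⋃ u : Fin 2 → V, separatedInfinite G u

theorem measurableSet_twoInfinite [Countable V] : MeasurableSet (twoInfinite G) :=
  MeasurableSet.iUnion fun u => measurableSet_separatedInfinite u

theorem shift_preimage_twoInfinite (g : G ≃g G) : shift g ⁻¹' twoInfinite G = twoInfinite G := by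
  ext ω
  simp only [twoInfinite, Set.mem_preimage, Set.mem_iUnion, shift_mem_separatedInfinite]
  constructor
  · rintro ⟨u, hu⟩
    exact ⟨_, hu⟩
  · rintro ⟨u, hu⟩
    exact ⟨fun a => g.symm (u a), by simpa using hu⟩

/-- If an edge of `s` and its image both lie within `M` of `o`, then `o` is moved by at most `2M`.
An infinite `S` offers a target farther away. -/
theorem exists_moving_automorphism [G.LocallyFinite] (hG : G.Connected) {d : ℕ}
    (hd : ∀ v, G.degree v ≤ d) {Γ : Subgroup (G ≃g G)} (hΓ : RestrictionActsTransitively Γ S)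
    (hSinf : S.Infinite) (s : Finset G.edgeSet) :
    ∃ g : G ≃g G, g '' S = S ∧ ∀ e ∈ s, g.mapEdgeSet e ∉ s := by
  obtain ⟨o, ho⟩ := hSinf.nonempty
  have hD : ∀ e : Sym2 V, ∃ D, ∀ v ∈ e, G.dist o v ≤ D := by
    intro e
    induction e using Sym2.ind with
    | _ x y => exact ⟨max (G.dist o x) (G.dist o y), by simp⟩
  choose D hD using hD
  set M := s.sup fun e => D e
  have hM : ∀ e ∈ s, ∀ v ∈ (e : Sym2 V), G.dist o v ≤ M := fun e he v hv =>
    (hD e v hv).trans (Finset.le_sup (f := fun e : G.edgeSet => D e) he)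
  obtain ⟨x, hx, hxM⟩ := (hSinf.sdiff (finite_ball G hG hd (2 * M) o)).nonempty
  obtain ⟨g, hg, hgx⟩ := hΓ.2 o ho x hx
  refine ⟨g, hΓ.1 g hg, fun e he hge => hxM ?_⟩
  obtain ⟨⟨a, b⟩, hab⟩ := e
  have h1 := hM _ he a (Sym2.mem_mk_left a b)
  have h2 := hM _ hge (g a) (Sym2.mem_mk_left (g a) (g b))
  have h3 := dist_iso hG g o a
  have h4 := hG.dist_triangle (u := o) (v := g a) (w := x)
  rw [hgx, SimpleGraph.dist_comm] at h3
  change G.dist o x ≤ 2 * M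
  omega

/-- Each infinite cluster after the opening contains an infinite old one, which must be that of `u
0` or `u 1`; these are now joined through `B`. -/
theorem openInside_notMem_twoInfinite {B : Finset V} (hB : (G.induce (B : Set V)).Connected)
    {u : Fin 2 → V} (hu : ∀ a, u a ∈ B) {ω : Config G} (hω : ω ∈ separatedInfinite G u)
    (h3 : ∀ u : Fin 3 → V, ω ∉ separatedInfinite G u) : openInside B ω ∉ twoInfinite G := by
  have hBr : ∀ x ∈ B, ∀ y ∈ B, (openGraph G (openInside B ω)).Reachable x y := by
    intro x hx y hy
    let φ : G.induce (B : Set V) →g openGraph G (openInside B ω) :=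
      ⟨fun v => v, fun {a b} h => openGraph_openInside_adj.2 (.inr ⟨h, a.2, b.2⟩)⟩
    exact (hB.preconnected ⟨x, hx⟩ ⟨y, hy⟩).map φ
  have key : ∀ x, (cluster G (openInside B ω) x).Infinite →
      (openGraph G (openInside B ω)).Reachable x (u 0) := by
    intro x hx
    obtain ⟨w, hxw, hw⟩ := exists_infinite_of_infinite (H := openGraph G ω) (B := (B : Set V))
      (fun a b h => (openGraph_openInside_adj.1 h).imp id And.right)
      (B.finite_toSet.inter_of_left _) hx
    by_cases hwu : ∃ a, (openGraph G ω).Reachable w (u a)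
    · obtain ⟨a, ha⟩ := hwu
      exact hxw.trans ((ha.mono (openGraph_le_openInside B ω)).trans (hBr _ (hu a) _ (hu 0)))
    · push Not at hwu
      refine absurd ?_ (h3 ![u 0, u 1, w])
      have h01 := hω.2 0 1 (by decide)
      refine ⟨fun a => ?_, fun a b hab h => ?_⟩
      · fin_cases a
        exacts [hω.1 0, hω.1 1, hw]
      · fin_cases a <;> fin_cases b
        exacts [hab rfl, h01 h, hwu 0 h.symm, h01 h.symm, hab rfl, hwu 1 h.symm, hwu 0 h, hwu 1 h,
          hab rfl]
  simp only [twoInfinite, Set.mem_iUnion, not_exists]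
  intro v hv
  exact hv.2 0 1 (by decide) ((key _ (hv.1 0)).trans (key _ (hv.1 1)).symm)

theorem ae_notMem_twoInfinite [G.LocallyFinite] (hG : G.Connected) {d : ℕ}
    (hd : ∀ v, G.degree v ≤ d) {Γ : Subgroup (G ≃g G)} (hS : (G.induce S).Connected)
    (hΓ : RestrictionActsTransitively Γ S) (hamen : IsAmenable (G.induce S)) (p q : I)
    (hp : (toNNReal p : ℝ≥0∞) * (d : ℝ≥0∞) ^ 2 < 1) :
    ∀ᵐ ω ∂percMeasure G S p q, ω ∉ twoInfinite G := by
  have := countable_of_locallyFinite G hG hd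
  have hp' : (toNNReal p : ℝ≥0∞) * d < 1 := by
    refine lt_of_le_of_lt ?_ hp
    gcongr
    exact_mod_cast Nat.le_self_pow (by norm_num) d
  have hfin := ae_finite_offGraph_cluster (S := S) hG hd p q hp'
  -- An infinite cluster would meet `S` infinitely often.
  by_cases hSfin : S.Finite
  · filter_upwards [hfin] with ω hω h
    obtain ⟨u, hu⟩ := Set.mem_iUnion.1 h
    exact infinite_cluster_inter hω (hu.1 0) (hSfin.inter_of_right _)
  -- Almost surely no edge inside `S` is open, so all clusters are off-`S` clusters, hence finite.
  by_cases hq : q = 0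
  · have hcl := ae_eq_false_of_eq_zero (edgeProb G S p q)
    rw [← percMeasure_eq] at hcl
    filter_upwards [hfin, hcl] with ω hω hcl h
    obtain ⟨u, hu⟩ := Set.mem_iUnion.1 h
    refine hu.1 0 ((hω (u 0)).subset fun v hv => ?_)
    refine SimpleGraph.Reachable.mono (fun x y hxy => ⟨hxy, fun hS => ?_⟩) hv
    obtain ⟨h1, h2⟩ := openGraph_adj.1 hxy
    have := hcl ⟨s(x, y), h1⟩ (by rw [edgeProb, if_pos (by simpa using hS), hq])
    rw [this] at h2
    cases h2
  have h3 := ae_forall_notMem_separatedInfinite_three hG hd hS hΓ hamen p q hq hp hfin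
  rcases measure_eq_zero_or_one_of_invariant (edgeProb G S p q)
    (measurableSet_twoInfinite (G := G)) fun s => by
      obtain ⟨g, hg, hgs⟩ := exists_moving_automorphism hG hd hΓ hSfin s
      exact ⟨g.mapEdgeSet, edgeProb_mapEdgeSet g hg p q, hgs, shift_preimage_twoInfinite g⟩
    with h0 | h1
  · exact measure_eq_zero_iff_ae_notMem.1 h0
  -- If two infinite clusters were almost sure, merging them would land in a null set, so by
  -- insertion tolerance no pair in `S` could be separated, and hence no pair at all.
  have hcompl : percMeasure G S p q (twoInfinite G)ᶜ = 0 :=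
    (prob_compl_eq_zero_iff measurableSet_twoInfinite).2 h1
  have hnone : ∀ᵐ ω ∂percMeasure G S p q, ∀ u : Fin 2 → V, (∀ a, u a ∈ S) →
      ω ∉ separatedInfinite G u := by
    refine ae_all_iff.2 fun u => ?_
    by_cases hu : ∀ a, u a ∈ S
    · obtain ⟨B, hBS, h0, h1, -, hB⟩ :=
        exists_connected_finset hS ⟨u 0, hu 0⟩ ⟨u 1, hu 1⟩ ⟨u 1, hu 1⟩
      have huB : ∀ a, u a ∈ B := by
        intro a
        fin_cases a
        exacts [h0, h1]
      have hD := measure_eq_zero_of_subset_preimage_openInside hBS p q hq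
        (D := {ω | ω ∈ separatedInfinite G u ∧ ∀ u : Fin 3 → V, ω ∉ separatedInfinite G u})
        (E := (twoInfinite G)ᶜ)
        (fun ω hω => openInside_notMem_twoInfinite hB huB hω.1 hω.2) hcompl
      filter_upwards [measure_eq_zero_iff_ae_notMem.1 hD, h3] with ω h1 h2 _ h
      exact h1 ⟨h, h2⟩
    · exact ae_of_all _ fun ω h => absurd h hu
  filter_upwards [hnone, hfin] with ω h1 h2 h
  obtain ⟨u, hu⟩ := Set.mem_iUnion.1 h
  obtain ⟨s, hs, hsω⟩ := exists_separatedInfinite_mem h2 hu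
  exact h1 s hs hsω

theorem numInfiniteClusters_eq_zero_or_one {ω : Config G} (h : ω ∉ twoInfinite G) :
    numInfiniteClusters G ω = 0 ∨ numInfiniteClusters G ω = 1 := by
  have hle : numInfiniteClusters G ω ≤ 1 := by
    refine Set.encard_le_one_iff.2 ?_
    rintro _ _ ⟨hu, u, rfl⟩ ⟨hv, v, rfl⟩
    by_contra hne
    have huv : ¬ (openGraph G ω).Reachable u v := fun h' => hne (cluster_eq_of_reachable h')
    refine h (Set.mem_iUnion.2 ⟨![u, v], fun a => ?_, fun a b hab h' => ?_⟩)
    · fin_cases a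
      exacts [hu, hv]
    · fin_cases a <;> fin_cases b
      exacts [hab rfl, huv h', huv h'.symm, hab rfl]
  rcases hle.lt_or_eq with h | h
  · exact .inl (Order.lt_one_iff.1 h)
  · exact .inr h

end Clusters

end InhomogeneousPercolation

theorem mainTheorem5 {V : Type*} (G : SimpleGraph V) [G.LocallyFinite] (hG : G.Connected)
    (d : ℕ) (hd : IsLUB (Set.range fun v : V => G.degree v) d)
    (Γ : Subgroup (G ≃g G)) (S : Set V) (hS : (G.induce S).Connected)
    (hΓ : InhomogeneousPercolation.RestrictionActsTransitively Γ S)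
    (hamen : InhomogeneousPercolation.IsAmenable (G.induce S))
    (p q : I) (hp : (p : ℝ) * (d : ℝ) ^ 2 < 1) :
    (∃ R : ℕ → Finset V, (∀ n, ((R n : Set V) ∩ S).Nonempty) ∧
      Tendsto (fun n =>
        InhomogeneousPercolation.expectedConnected G S p q
            (InhomogeneousPercolation.exteriorBoundary G (R n : Set V)) /
          (((R n : Set V) ∩ S).encard : ℝ≥0∞))
        atTop (𝓝 0)) ∧
    ∀ᵐ ω ∂(InhomogeneousPercolation.percMeasure G S p q),
      InhomogeneousPercolation.numInfiniteClusters G ω = 0 ∨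
        InhomogeneousPercolation.numInfiniteClusters G ω = 1 := by
  have hdeg : ∀ v, G.degree v ≤ d := fun v => hd.1 ⟨v, rfl⟩
  have hp' : (toNNReal p : ℝ≥0∞) * (d : ℝ≥0∞) ^ 2 < 1 := by
    have h : toNNReal p * (d : NNReal) ^ 2 < 1 := by
      rw [← NNReal.coe_lt_coe]
      exact_mod_cast hp
    exact_mod_cast h
  refine ⟨InhomogeneousPercolation.exists_seq_tendsto_zero hG hdeg hS hΓ hamen p q hp', ?_⟩
  filter_upwards [InhomogeneousPercolation.ae_notMem_twoInfinite hG hdeg hS hΓ hamen p q hp']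
    with ω hω
  exact InhomogeneousPercolation.numInfiniteClusters_eq_zero_or_one hω
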